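/- Let $m\ge n$ be natural numbers and $\nu=m-n\ge 0$. Let $X$ be an $m\times n$ random complex matrix such that the $2mn$ real random variables $\operatorname{Re}X_{i,j}$, $\operatorname{Im}X_{i,j}$ ($1\le i\le m$, $1\le j\le n$) are independent and normal with mean $0$ and variance $1/2$. Then the squared singular values $x_1,\dots,x_n$ of $X$ (the eigenvalues of $X^*X$, counted with multiplicity, taken in no particular order) have the joint density $$\frac1{Z_n}\prod_{1\le i<j\le n}(x_j-x_i)^2\prod_{j=1}^n x_j^{\nu}e^{-x_j},\qquad\text{all } x_j>0,$$ where the normalization constant $Z_n=\int_{(0,\infty)^n}\prod_{i<j}(x_j-x_i)^2\prod_{j}x_j^{\nu}e^{-x_j}\,dx$ is finite and positive. Here the joint density of the unordered values means the density of the vector obtained by listing the eigenvalues in a uniformly random order independent of $X$. Equivalently, the vector of squared singular values in increasing order has the density $\frac{n!}{Z_n}\prod_{i<j}(x_j-x_i)^2\prod_{j}x_j^{\nu}e^{-x_j}$ on $\{0<x_1<\dots<x_n\}$. -/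

import Mathlib

open MeasureTheory ProbabilityTheory
open scoped ENNReal NNReal

/-- `X` is an `m × n` random matrix such that the real and imaginary parts of its entries
(`2 * m * n` real random variables in all) are independent normal random variables with
mean `0` and variance `1/2`. The tag `true` stands for the real part, `false` for the
imaginary part. -/
structure IsComplexGinibre {Ω : Type*} [MeasurableSpace Ω] {m n : ℕ}
    (X : Ω → Matrix (Fin m) (Fin n) ℂ) (P : Measure Ω) : Prop where
  re_law : ∀ i j, HasLaw (fun ω => (X ω i j).re) (gaussianReal 0 (1 / 2 : ℝ≥0)) P
  im_law : ∀ i j, HasLaw (fun ω => (X ω i j).im) (gaussianReal 0 (1 / 2 : ℝ≥0)) P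
  indep : iIndepFun
    (fun (k : Fin m × Fin n × Bool) (ω : Ω) =>
      if k.2.2 then (X ω k.1 k.2.1).re else (X ω k.1 k.2.1).im) P

/-- The squared singular values of `X`: the eigenvalues of `Xᴴ * X`, repeated according to
multiplicity and listed in increasing order. (Mathlib's `eigenvalues₀` lists them in
decreasing order.) -/
noncomputable def sqSingularValues {m n : ℕ} (X : Matrix (Fin m) (Fin n) ℂ) : Fin n → ℝ :=
  fun i => (Matrix.isHermitian_conjTranspose_mul_self X).eigenvalues₀
    (Fin.cast (Fintype.card_fin n).symm i.rev)

/-- The law of the random vector `x` after its coordinates have been put into a uniformly random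
order, independent of `x`. The unordered random points `x ω 0, …, x ω (n - 1)` have
the joint density `p` when this law has density `p`. -/
noncomputable def unorderedLaw {Ω : Type*} [MeasurableSpace Ω] {n : ℕ}
    (x : Ω → Fin n → ℝ) (P : Measure Ω) : Measure (Fin n → ℝ) :=
  ((n.factorial : ℝ≥0∞))⁻¹ • ∑ σ : Equiv.Perm (Fin n), P.map (fun ω => x ω ∘ σ)

/-- The function `∏_{i<j} (x_j - x_i)² * ∏_j x_j ^ ν * exp (-x_j)`. -/
noncomputable def laguerreWeight (n ν : ℕ) (x : Fin n → ℝ) : ℝ :=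
  (∏ i, ∏ j ∈ Finset.Ioi i, (x j - x i) ^ 2) * ∏ j, (x j ^ ν * Real.exp (-x j))

/-- The normalization constant: the integral of the weight over the positive orthant. -/
noncomputable def laguerreZ (n ν : ℕ) : ℝ :=
  ∫ x in {x : Fin n → ℝ | ∀ j, 0 < x j}, laguerreWeight n ν x

/-! ### Product measures and densities -/

/-! The matrix is built row by row, and the density of the ordered spectrum of `Xᴴ * X` is followed
along the way. Write Δ for the Vandermonde product.

Appending a row v replaces the Gram matrix A by A + v*v. The Gaussian law is unitarily invariant, so
A may be taken to be diagonal with entries x. The new characteristic polynomial is then the secular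
polynomial with weights w_i = |v_i|², which are independent standard exponential variables. For
strictly increasing x, the map from w to the roots y is a bijection from the positive orthant onto
the y interlacing x. The Jacobian of its inverse is Δ(y)/Δ(x) in absolute value, and the trace gives
Σ w = Σ y - Σ x. Hence the transition density from x to y is Δ(y)/Δ(x) · exp(-(Σ y - Σ x)) on
interlacing pairs (`lintegral_orderedSpectrum_diagonal_add`).

Multiply this by the weight Δ(x)² ∏ x_i^ν exp(-Σ x). One factor Δ(x) and exp(-Σ x) cancel, leaving
Δ(y) exp(-Σ y) · ∏ x_i^ν Δ(x). For fixed y the interlacing x fill a box, and the integral of the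
determinant ∏ x_i^ν Δ(x) over it is a constant times ∏ y_i^(ν+1) Δ(y), by row operations. So one
more row raises ν by one.

The induction on ν starts from square matrices. Deleting a row of a square matrix of size k+1 leaves
a wide matrix. Its Gram spectrum is a zero followed by the spectrum of its adjoint, which is a
Gaussian (k+1) × k matrix with ν = 1. The same kernel, started at (0, x), gives the weight with ν =
0 in dimension k+1. Both steps are instances of `exists_density_of_spectralTransition`.

Constants are never tracked: total mass one determines the final constant and also shows that the
normalizing integral is finite and positive. Since the weight is symmetric and the permuted Weyl
chambers tile the orthant up to a null set, the unordered density follows. -/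

theorem lintegral_fin_prod_eq_prod {E : Type*} [MeasurableSpace E] (μ : Measure E) [SigmaFinite μ] :
    ∀ {n : ℕ} {f : Fin n → E → ℝ≥0∞}, (∀ i, Measurable (f i)) →
      ∫⁻ x, ∏ i, f i (x i) ∂(Measure.pi fun _ : Fin n => μ) = ∏ i, ∫⁻ t, f i t ∂μ := by
  intro n
  induction n with
  | zero => intro f _; simp
  | succ n ih =>
    intro f hf
    rw [← ((measurePreserving_piFinSuccAbove (fun _ : Fin (n + 1) => μ) 0).symm).lintegral_comp_emb
      (MeasurableEquiv.measurableEmbedding _), Fin.prod_univ_succ, ← ih fun i => hf i.succ,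
      ← lintegral_prod_mul (hf 0).aemeasurable
        (Finset.measurable_prod _ fun i _ =>
          (hf i.succ).comp (measurable_pi_apply i)).aemeasurable]
    simp_rw [MeasurableEquiv.piFinSuccAbove_symm_apply, Fin.insertNthEquiv, Fin.prod_univ_succ]
    rfl

theorem pi_withDensity_eq {E : Type*} [MeasurableSpace E] (μ : Measure E) [SigmaFinite μ] {n : ℕ}
    {f : E → ℝ≥0∞} (hf : Measurable f) [SigmaFinite (μ.withDensity f)] :
    Measure.pi (fun _ : Fin n => μ.withDensity f) =
      (Measure.pi fun _ : Fin n => μ).withDensity fun x => ∏ i, f (x i) := by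
  refine Measure.pi_eq fun s hs => ?_
  rw [withDensity_apply _ (MeasurableSet.univ_pi hs),
    ← lintegral_indicator (MeasurableSet.univ_pi hs)]
  have : ∀ x : Fin n → E, (Set.univ.pi s).indicator (fun x => ∏ i, f (x i)) x =
      ∏ i, (s i).indicator f (x i) := by
    intro x
    by_cases hx : x ∈ Set.univ.pi s
    · rw [Set.indicator_of_mem hx]
      exact Finset.prod_congr rfl fun i _ => (Set.indicator_of_mem (hx i trivial) _).symm
    · rw [Set.indicator_of_notMem hx]
      simp only [Set.mem_pi, Set.mem_univ, forall_const, not_forall] at hx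
      obtain ⟨i, hi⟩ := hx
      exact (Finset.prod_eq_zero (Finset.mem_univ i) (Set.indicator_of_notMem hi _)).symm
  simp_rw [this]
  rw [lintegral_fin_prod_eq_prod μ fun i => hf.indicator (hs i)]
  exact Finset.prod_congr rfl fun i _ => by
    rw [lintegral_indicator (hs i), withDensity_apply _ (hs i)]

/-! ### The standard complex Gaussian law -/

/-- The standard complex Gaussian law: independent real and imaginary parts of variance `1/2`. -/
noncomputable def complexGaussian : Measure ℂ :=
  ((gaussianReal 0 (1 / 2 : ℝ≥0)).prod (gaussianReal 0 (1 / 2 : ℝ≥0))).map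
    Complex.measurableEquivRealProd.symm

instance : IsProbabilityMeasure complexGaussian :=
  Measure.isProbabilityMeasure_map Complex.measurableEquivRealProd.symm.measurable.aemeasurable

/-- The density of the standard complex Gaussian law. -/
noncomputable def complexGaussianPDF (z : ℂ) : ℝ≥0∞ :=
  ENNReal.ofReal (Real.pi⁻¹ * Real.exp (-Complex.normSq z))

theorem measurable_complexGaussianPDF : Measurable complexGaussianPDF := by
  unfold complexGaussianPDF
  have : Measurable Complex.normSq := Complex.continuous_normSq.measurable
  fun_prop

theorem complexGaussian_eq_withDensity :
    complexGaussian = volume.withDensity complexGaussianPDF := by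
  refine Measure.ext_of_lintegral _ fun g hg => ?_
  have hpdf := measurable_complexGaussianPDF
  have hh : (1 / 2 : ℝ≥0) ≠ 0 := by norm_num
  rw [lintegral_withDensity_eq_lintegral_mul _ hpdf hg, complexGaussian,
    lintegral_map hg Complex.measurableEquivRealProd.symm.measurable,
    gaussianReal_of_var_ne_zero _ hh,
    prod_withDensity (measurable_gaussianPDF _ _) (measurable_gaussianPDF _ _),
    lintegral_withDensity_eq_lintegral_mul _ (by fun_prop)
      (show Measurable fun p => g (Complex.measurableEquivRealProd.symm p) from
        hg.comp Complex.measurableEquivRealProd.symm.measurable),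
    ← (Complex.volume_preserving_equiv_real_prod.symm).lintegral_comp_emb
      Complex.measurableEquivRealProd.symm.measurableEmbedding]
  refine lintegral_congr fun p => ?_
  simp only [Pi.mul_apply]
  congr 1
  rw [gaussianPDF, gaussianPDF, ← ENNReal.ofReal_mul (gaussianPDFReal_nonneg _ _ _),
    complexGaussianPDF]
  congr 1
  simp only [gaussianPDFReal, Complex.measurableEquivRealProd_symm_apply, Complex.normSq_mk]
  have h1 : √(2 * Real.pi * ((1 / 2 : ℝ≥0) : ℝ)) = √Real.pi := by
    congr 1; push_cast; ring
  rw [h1, mul_mul_mul_comm, ← mul_inv, Real.mul_self_sqrt Real.pi_pos.le, ← Real.exp_add]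
  congr 2
  push_cast
  ring

/-- The squared modulus of a standard complex Gaussian variable is exponentially distributed. -/
theorem map_normSq_complexGaussian :
    complexGaussian.map Complex.normSq =
      (volume.restrict (Set.Ioi (0 : ℝ))).withDensity fun t => ENNReal.ofReal (Real.exp (-t)) := by
  have hn : Measurable Complex.normSq := Complex.continuous_normSq.measurable
  have he : Measurable fun t : ℝ => ENNReal.ofReal (Real.exp (-t)) := by fun_prop
  refine Measure.ext_of_lintegral _ fun g hg => ?_
  rw [lintegral_map hg hn, complexGaussian_eq_withDensity,
    lintegral_withDensity_eq_lintegral_mul _ measurable_complexGaussianPDF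
      (show Measurable fun z => g (Complex.normSq z) from hg.comp hn),
    lintegral_withDensity_eq_lintegral_mul _ he hg, ← Complex.lintegral_comp_polarCoord_symm]
  have himg : (fun r : ℝ => r ^ 2) '' Set.Ioi 0 = Set.Ioi 0 := by
    ext t
    constructor
    · rintro ⟨r, hr, rfl⟩
      exact pow_pos (Set.mem_Ioi.1 hr) 2
    · intro ht
      exact ⟨√t, Real.sqrt_pos.2 ht, Real.sq_sqrt (le_of_lt ht)⟩
  have hinj : Set.InjOn (fun r : ℝ => r ^ 2) (Set.Ioi 0) := fun a ha b hb h =>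
    (pow_left_inj₀ (le_of_lt ha) (le_of_lt hb) two_ne_zero).1 h
  have hder : ∀ r ∈ Set.Ioi (0 : ℝ), HasDerivWithinAt (fun r : ℝ => r ^ 2) (2 * r) (Set.Ioi 0) r :=
    fun r _ => by simpa using (hasDerivAt_pow 2 r).hasDerivWithinAt
  -- Substitution t = r². The Jacobian 2r matches the polar factor r times the angular length 2π
  -- times the constant π⁻¹ of the density.
  have hcv := lintegral_image_eq_lintegral_abs_deriv_mul measurableSet_Ioi hder hinj
    ((fun t : ℝ => ENNReal.ofReal (Real.exp (-t))) * g)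
  rw [himg] at hcv
  rw [hcv, polarCoord_target, Measure.volume_eq_prod, ← Measure.prod_restrict, lintegral_prod]
  · refine setLIntegral_congr_fun measurableSet_Ioi fun r hr => ?_
    have hr' : (0 : ℝ) < r := hr
    have hns : ∀ θ : ℝ, Complex.normSq (Complex.polarCoord.symm (r, θ)) = r ^ 2 := by
      intro θ
      rw [Complex.normSq_eq_norm_sq, Complex.norm_polarCoord_symm]
      simp
    simp only [Pi.mul_apply, complexGaussianPDF, hns, smul_eq_mul]
    rw [lintegral_const, Measure.restrict_apply_univ, Real.volume_Ioo, abs_of_pos (by positivity),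
      mul_comm _ (ENNReal.ofReal (Real.pi - -Real.pi)), ← mul_assoc, ← mul_assoc, ← mul_assoc,
      ← ENNReal.ofReal_mul (by linarith [Real.pi_pos]),
      ← ENNReal.ofReal_mul (mul_nonneg (by linarith [Real.pi_pos]) hr'.le),
      ← ENNReal.ofReal_mul (by positivity)]
    congr 2
    field_simp
    ring
  · have h1 : Measurable (Complex.polarCoord.symm : ℝ × ℝ → ℂ) := by
      have : (Complex.polarCoord.symm : ℝ × ℝ → ℂ) =
          fun p => p.1 * (Real.cos p.2 + Real.sin p.2 * Complex.I) := by
        ext p; exact Complex.polarCoord_symm_apply p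
      rw [this]; fun_prop
    exact ((measurable_fst.ennreal_ofReal).mul
      ((measurable_complexGaussianPDF.mul (hg.comp hn)).comp h1)).aemeasurable

/-- The joint law of the squared moduli of independent standard complex Gaussian variables. -/
theorem map_normSq_pi_complexGaussian (n : ℕ) :
    (Measure.pi fun _ : Fin n => complexGaussian).map (fun v i => Complex.normSq (v i)) =
      (volume.restrict {w : Fin n → ℝ | ∀ i, 0 < w i}).withDensity
        fun w => ENNReal.ofReal (Real.exp (-∑ i, w i)) := by
  have hn : Measurable Complex.normSq := Complex.continuous_normSq.measurable
  have hprob : IsProbabilityMeasure (complexGaussian.map Complex.normSq) :=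
    Measure.isProbabilityMeasure_map hn.aemeasurable
  rw [Measure.pi_map_pi fun _ => hn.aemeasurable]
  rw [map_normSq_complexGaussian] at hprob ⊢
  rw [pi_withDensity_eq _ (by fun_prop), ← Measure.restrict_pi_pi, ← volume_pi]
  congr 1
  · congr 1
    ext w; simp
  · ext w
    rw [← ENNReal.ofReal_prod_of_nonneg fun i _ => (Real.exp_pos _).le, ← Real.exp_sum,
      Finset.sum_neg_distrib]

/-- Linear isometries preserve the standard complex Gaussian law on `ℂⁿ`. -/
theorem measurePreserving_pi_complexGaussian {n : ℕ} (L : (Fin n → ℂ) ≃ₗ[ℂ] (Fin n → ℂ))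
    (hL : ∀ v, ∑ i, Complex.normSq (L v i) = ∑ i, Complex.normSq (v i)) :
    MeasurePreserving L (Measure.pi fun _ : Fin n => complexGaussian)
      (Measure.pi fun _ : Fin n => complexGaussian) := by
  set γ := Measure.pi fun _ : Fin n => complexGaussian with hγ
  have hprob : IsProbabilityMeasure (volume.withDensity complexGaussianPDF) :=
    complexGaussian_eq_withDensity ▸ inferInstance
  have hpdf := measurable_complexGaussianPDF
  have hdens : γ = volume.withDensity fun v : Fin n → ℂ => ∏ i, complexGaussianPDF (v i) := by
    rw [hγ, complexGaussian_eq_withDensity, pi_withDensity_eq _ measurable_complexGaussianPDF,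
      ← volume_pi]
  set p : (Fin n → ℂ) → ℝ≥0∞ := fun v => ∏ i, complexGaussianPDF (v i) with hp
  have hpm : Measurable p := by
    rw [hp]
    exact Finset.measurable_prod _ fun i _ => hpdf.comp (measurable_pi_apply i)
  have hpL : ∀ v, p (L v) = p v := by
    intro v
    simp only [hp, complexGaussianPDF]
    rw [← ENNReal.ofReal_prod_of_nonneg fun i _ => by positivity,
      ← ENNReal.ofReal_prod_of_nonneg fun i _ => by positivity,
      Finset.prod_mul_distrib, Finset.prod_mul_distrib, ← Real.exp_sum, ← Real.exp_sum,
      Finset.sum_neg_distrib, Finset.sum_neg_distrib, hL]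
  let L' : (Fin n → ℂ) ≃L[ℂ] (Fin n → ℂ) := L.toContinuousLinearEquiv
  have hLm : Measurable L := L'.continuous.measurable
  -- By uniqueness of Haar measure, `L` scales volume by some constant c. The density depends only
  -- on the norm, so `L` scales the Gaussian law by the same c, and total mass one gives c = 1
  -- without computing a determinant.
  have hvol := Measure.isAddLeftInvariant_eq_smul
    ((volume : Measure (Fin n → ℂ)).map L') (volume : Measure (Fin n → ℂ))
  set c := ((volume : Measure (Fin n → ℂ)).map L').addHaarScalarFactor volume
  have hint : ∀ g : (Fin n → ℂ) → ℝ≥0∞, Measurable g →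
      ∫⁻ v, g (L v) ∂γ = c * ∫⁻ v, g v ∂γ := by
    intro g hg
    rw [hdens, lintegral_withDensity_eq_lintegral_mul _ hpm
        (show Measurable fun v => g (L v) from hg.comp hLm),
      lintegral_withDensity_eq_lintegral_mul _ hpm hg]
    have : ∫⁻ v, (p * g) v ∂((volume : Measure (Fin n → ℂ)).map L') =
        c * ∫⁻ v, (p * g) v := by
      rw [hvol, lintegral_smul_measure]; rfl
    rw [← this, lintegral_map (hpm.mul hg) L'.continuous.measurable]
    refine lintegral_congr fun v => ?_
    change p v * g (L v) = p (L v) * g (L v)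
    rw [hpL]
  have hc : (c : ℝ≥0∞) = 1 := by
    have := hint (fun _ => 1) measurable_const
    simpa using this.symm
  refine ⟨hLm, Measure.ext_of_lintegral _ fun g hg => ?_⟩
  rw [lintegral_map hg hLm, hint g hg, hc, one_mul]

/-! ### The ordered spectrum of a Hermitian matrix -/

theorem Monotone.eq_of_map_univ_eq {n : ℕ} {f g : Fin n → ℝ} (hf : Monotone f) (hg : Monotone g)
    (h : Multiset.map f Finset.univ.val = Multiset.map g Finset.univ.val) : f = g := by
  rw [Fin.univ_val_map, Fin.univ_val_map, Multiset.coe_eq_coe] at h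
  exact List.ofFn_injective (h.eq_of_pairwise (fun a b _ _ => le_antisymm)
    (List.sortedLE_iff_pairwise.1 hf.sortedLE_ofFn) (List.sortedLE_iff_pairwise.1 hg.sortedLE_ofFn))

theorem Polynomial.roots_prod_X_sub_C_fin {R : Type*} [CommRing R] [IsDomain R] {n : ℕ}
    (f : Fin n → R) :
    (∏ i, (Polynomial.X - Polynomial.C (f i))).roots = Multiset.map f Finset.univ.val := by
  rw [Polynomial.roots_prod]
  · simp
  · simp [Finset.prod_ne_zero_iff, Polynomial.X_sub_C_ne_zero]

theorem Monotone.eq_of_prod_X_sub_C_eq {n : ℕ} {f g : Fin n → ℝ} (hf : Monotone f)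
    (hg : Monotone g)
    (h : ∏ i, (Polynomial.X - Polynomial.C (f i)) = ∏ i, (Polynomial.X - Polynomial.C (g i))) :
    f = g := by
  refine hf.eq_of_map_univ_eq hg ?_
  rw [← Polynomial.roots_prod_X_sub_C_fin, ← Polynomial.roots_prod_X_sub_C_fin, h]

theorem Monotone.eq_of_prod_X_sub_C_ofReal_eq {n : ℕ} {f g : Fin n → ℝ} (hf : Monotone f)
    (hg : Monotone g)
    (h : ∏ i, (Polynomial.X - Polynomial.C (f i : ℂ)) =
      ∏ i, (Polynomial.X - Polynomial.C (g i : ℂ))) : f = g := by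
  refine hf.eq_of_prod_X_sub_C_eq hg
    (Polynomial.map_injective Complex.ofRealHom Complex.ofRealHom.injective ?_)
  simpa [Polynomial.map_prod] using h

/-- A monotone family of `n` roots is determined by the values of its monic polynomial at
`n` points. -/
theorem Monotone.eq_of_prod_sub_eq {n : ℕ} {f g t : Fin n → ℝ} (hf : Monotone f)
    (hg : Monotone g) (ht : Function.Injective t)
    (h : ∀ k, ∏ i, (t k - f i) = ∏ i, (t k - g i)) : f = g := by
  refine hf.eq_of_prod_X_sub_C_eq hg ?_
  refine Polynomial.eq_of_degree_sub_lt_of_eval_index_eq (v := t) Finset.univ ht.injOn ?_ ?_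
  · refine lt_of_lt_of_eq (Polynomial.degree_sub_lt_left ?_ ?_ ?_) ?_
    · rw [Polynomial.degree_prod, Polynomial.degree_prod]; simp
    · exact (Polynomial.monic_prod_of_monic _ _ fun i _ => Polynomial.monic_X_sub_C _).ne_zero
    · rw [(Polynomial.monic_prod_of_monic _ _ fun i _ => Polynomial.monic_X_sub_C _).leadingCoeff,
        (Polynomial.monic_prod_of_monic _ _ fun i _ => Polynomial.monic_X_sub_C _).leadingCoeff]
    · rw [Polynomial.degree_prod]; simp
  · intro k _
    simpa [Polynomial.eval_prod] using h k

open scoped Classical in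
/-- The eigenvalues of a Hermitian matrix in increasing order (zero if `A` is not Hermitian). -/
noncomputable def orderedSpectrum {n : ℕ} (A : Matrix (Fin n) (Fin n) ℂ) : Fin n → ℝ :=
  if hA : A.IsHermitian then
    fun i => hA.eigenvalues₀ (Fin.cast (Fintype.card_fin n).symm i.rev)
  else 0

theorem sqSingularValues_eq_orderedSpectrum {m n : ℕ} (X : Matrix (Fin m) (Fin n) ℂ) :
    sqSingularValues X = orderedSpectrum (X.conjTranspose * X) := by
  rw [orderedSpectrum, dif_pos (Matrix.isHermitian_conjTranspose_mul_self X)]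
  rfl

section OrderedSpectrum

variable {n : ℕ} {A : Matrix (Fin n) (Fin n) ℂ}

theorem monotone_orderedSpectrum (hA : A.IsHermitian) : Monotone (orderedSpectrum A) := by
  rw [orderedSpectrum, dif_pos hA]
  intro i j hij
  exact hA.eigenvalues₀_antitone (by simpa [Fin.le_def] using Fin.rev_le_rev.2 hij)

theorem charpoly_eq_prod_orderedSpectrum (hA : A.IsHermitian) :
    A.charpoly = ∏ i, (Polynomial.X - Polynomial.C (orderedSpectrum A i : ℂ)) := by
  rw [hA.charpoly_eq, orderedSpectrum, dif_pos hA]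
  simp only [Matrix.IsHermitian.eigenvalues]
  refine (Equiv.prod_comp (Fintype.equivOfCardEq (Fintype.card_fin _)).symm
    (fun i => Polynomial.X - Polynomial.C ((hA.eigenvalues₀ i : ℝ) : ℂ))).trans ?_
  exact (Equiv.prod_comp (Fin.revPerm.trans (finCongr (Fintype.card_fin n).symm))
    (fun i => Polynomial.X - Polynomial.C ((hA.eigenvalues₀ i : ℝ) : ℂ))).symm

theorem orderedSpectrum_eq_of_charpoly (hA : A.IsHermitian) {y : Fin n → ℝ} (hy : Monotone y)
    (h : A.charpoly = ∏ i, (Polynomial.X - Polynomial.C (y i : ℂ))) : orderedSpectrum A = y :=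
  (monotone_orderedSpectrum hA).eq_of_prod_X_sub_C_ofReal_eq hy
    (by rw [← charpoly_eq_prod_orderedSpectrum hA, h])

theorem orderedSpectrum_congr {B : Matrix (Fin n) (Fin n) ℂ} (hA : A.IsHermitian)
    (hB : B.IsHermitian) (h : A.charpoly = B.charpoly) : orderedSpectrum A = orderedSpectrum B :=
  orderedSpectrum_eq_of_charpoly hA (monotone_orderedSpectrum hB)
    (by rw [h, charpoly_eq_prod_orderedSpectrum hB])

theorem det_sub_eq_prod_orderedSpectrum (hA : A.IsHermitian) (t : ℂ) :
    (Matrix.scalar (Fin n) t - A).det = ∏ i, (t - (orderedSpectrum A i : ℂ)) := by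
  rw [← Matrix.eval_charpoly, charpoly_eq_prod_orderedSpectrum hA, Polynomial.eval_prod]
  simp

/-- The values of the characteristic polynomial at 0, …, n-1 are polynomial in the entries, hence
measurable, and they determine the increasing eigenvalue vector. Measurability passes back through
this injection by the Lusin–Souslin theorem: a Borel set has a Borel image under an injective Borel
map. -/
theorem measurable_orderedSpectrum {α : Type*} [MeasurableSpace α]
    {f : α → Matrix (Fin n) (Fin n) ℂ} (hf : ∀ i j, Measurable fun a => f a i j)
    (hH : ∀ a, (f a).IsHermitian) : Measurable fun a => orderedSpectrum (f a) := by
  let Φ : (Fin n → ℝ) → Fin n → ℝ := fun y k => ∏ i, (((k : ℕ) : ℝ) - y i)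
  have hΦ : Measurable Φ := by
    refine measurable_pi_lambda _ fun k => Finset.measurable_prod _ fun i _ => ?_
    fun_prop
  have hinj : Set.InjOn Φ {y | Monotone y} := by
    intro y hy z hz h
    refine Monotone.eq_of_prod_sub_eq hy hz (t := fun k : Fin n => ((k : ℕ) : ℝ)) ?_ ?_
    · intro a b hab
      simpa [Fin.ext_iff] using hab
    · intro k
      exact congrFun h k
  have hval : ∀ a k, Φ (orderedSpectrum (f a)) k =
      ((Matrix.scalar (Fin n) (((k : ℕ) : ℝ) : ℂ) - f a).det).re := by
    intro a k
    rw [det_sub_eq_prod_orderedSpectrum (hH a)]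
    simp only [Φ]
    rw [← Complex.ofReal_re (∏ i, (((k : ℕ) : ℝ) - orderedSpectrum (f a) i))]
    push_cast
    rfl
  have hmeas : Measurable fun a => Φ (orderedSpectrum (f a)) := by
    refine measurable_pi_lambda _ fun k => ?_
    simp_rw [hval, Matrix.det_apply]
    refine Complex.measurable_re.comp (Finset.measurable_sum _ fun σ _ => ?_)
    refine Measurable.const_smul (Finset.measurable_prod _ fun i _ => ?_) _
    simp only [Matrix.sub_apply]
    exact (measurable_const).sub (hf _ _)
  intro s hs
  have hpre : (fun a => orderedSpectrum (f a)) ⁻¹' s =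
      (fun a => Φ (orderedSpectrum (f a))) ⁻¹' (Φ '' (s ∩ {y | Monotone y})) := by
    ext a
    constructor
    · intro ha
      exact ⟨_, ⟨ha, monotone_orderedSpectrum (hH a)⟩, rfl⟩
    · rintro ⟨y, ⟨hys, hy⟩, h⟩
      have := hinj hy (monotone_orderedSpectrum (hH a)) h
      simpa [this] using hys
  rw [hpre]
  exact hmeas (MeasurableSet.image_of_measurable_injOn (hs.inter isClosed_monotone.measurableSet)
    hΦ (hinj.mono Set.inter_subset_right))

end OrderedSpectrum

/-! ### Vandermonde products -/

/-- The Vandermonde product `∏_{i<j} (x_j - x_i)`. -/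
noncomputable def vandermondeProd {n : ℕ} (x : Fin n → ℝ) : ℝ :=
  ∏ i, ∏ j ∈ Finset.Ioi i, (x j - x i)

theorem det_vandermonde_eq_vandermondeProd {n : ℕ} (x : Fin n → ℝ) :
    (Matrix.vandermonde x).det = vandermondeProd x := Matrix.det_vandermonde x

theorem StrictMono.vandermondeProd_pos {n : ℕ} {x : Fin n → ℝ} (hx : StrictMono x) :
    0 < vandermondeProd x :=
  Finset.prod_pos fun _ _ => Finset.prod_pos fun _ hj => sub_pos.2 (hx (Finset.mem_Ioi.1 hj))

theorem prod_erase_eq_prod_Iio_mul_prod_Ioi {n : ℕ} {M : Type*} [CommMonoid M] (i : Fin n)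
    (f : Fin n → M) :
    ∏ j ∈ Finset.univ.erase i, f j = (∏ j ∈ Finset.Iio i, f j) * ∏ j ∈ Finset.Ioi i, f j := by
  rw [← Finset.prod_union]
  · congr 1
    ext j
    simp [lt_or_lt_iff_ne]
  · rw [Finset.disjoint_left]
    intro j h1 h2
    exact lt_asymm (Finset.mem_Iio.1 h1) (Finset.mem_Ioi.1 h2)

/-- Every unordered pair of indices contributes twice, once from each end. -/
theorem abs_prod_prod_erase_eq_sq {n : ℕ} (x : Fin n → ℝ) :
    |∏ i, ∏ j ∈ Finset.univ.erase i, (x i - x j)| = vandermondeProd x ^ 2 := by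
  rw [← sq_abs, vandermondeProd, sq]
  simp_rw [prod_erase_eq_prod_Iio_mul_prod_Ioi, Finset.abs_prod, abs_mul, Finset.abs_prod,
    Finset.prod_mul_distrib]
  congr 1
  · exact Finset.prod_comm' (by simp)
  · simp_rw [abs_sub_comm]

/-! ### Interlacing sequences and the secular equation -/

/-- `x₀ < y₀ < x₁ < y₁ < ⋯ < xₙ₋₁ < yₙ₋₁`. -/
def Interlaces {n : ℕ} (x y : Fin n → ℝ) : Prop :=
  (∀ i, x i < y i) ∧ ∀ i j, i < j → y i < x j

namespace Interlaces

variable {n : ℕ} {x y : Fin n → ℝ}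

theorem strictMono_left (h : Interlaces x y) : StrictMono x :=
  fun i j hij => (h.1 i).trans (h.2 i j hij)

theorem strictMono_right (h : Interlaces x y) : StrictMono y :=
  fun i j hij => (h.2 i j hij).trans (h.1 j)

end Interlaces

/-- The monic polynomial `∏_j (X - x_j) - ∑_i w_i ∏_{j≠i} (X - x_j)`, whose roots are the zeros of
the secular function `1 - ∑_i w_i / (X - x_i)`. -/
noncomputable def secularPoly {n : ℕ} (x w : Fin n → ℝ) : Polynomial ℝ :=
  ∏ j, (Polynomial.X - Polynomial.C (x j)) -
    ∑ i, Polynomial.C (w i) * ∏ j ∈ Finset.univ.erase i, (Polynomial.X - Polynomial.C (x j))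

section SecularPoly

open Polynomial

variable {n : ℕ} (x w : Fin n → ℝ)

theorem degree_sum_secularPoly_lt :
    (∑ i, C (w i) * ∏ j ∈ Finset.univ.erase i, (X - C (x j))).degree < n := by
  rw [← mem_degreeLT]
  refine Submodule.sum_mem _ fun i _ => ?_
  rw [mem_degreeLT]
  refine lt_of_le_of_lt ((smul_eq_C_mul (w i)).symm ▸ degree_smul_le _ _) ?_
  rw [degree_prod]
  have : 0 < n := i.pos
  simp only [degree_X_sub_C, Finset.sum_const, Finset.card_erase_of_mem (Finset.mem_univ i),
    Finset.card_univ, Fintype.card_fin, nsmul_eq_mul, mul_one]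
  exact_mod_cast Nat.sub_lt this one_pos

theorem degree_prod_X_sub_C_fin : (∏ j, (X - C (x j))).degree = (n : WithBot ℕ) := by
  rw [degree_prod]; simp

theorem monic_prod_X_sub_C_fin : (∏ j, (X - C (x j))).Monic :=
  monic_prod_of_monic _ _ fun _ _ => monic_X_sub_C _

theorem monic_secularPoly : (secularPoly x w).Monic :=
  (monic_prod_X_sub_C_fin x).sub_of_left
    (by rw [degree_prod_X_sub_C_fin]; exact degree_sum_secularPoly_lt x w)

theorem degree_secularPoly : (secularPoly x w).degree = n := by
  rw [secularPoly, degree_sub_eq_left_of_degree_lt, degree_prod_X_sub_C_fin]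
  rw [degree_prod_X_sub_C_fin]; exact degree_sum_secularPoly_lt x w

theorem eval_secularPoly (t : ℝ) : (secularPoly x w).eval t =
    ∏ j, (t - x j) - ∑ i, w i * ∏ j ∈ Finset.univ.erase i, (t - x j) := by
  simp [secularPoly, eval_prod, eval_finsetSum]

theorem eval_secularPoly_node (i : Fin n) : (secularPoly x w).eval (x i) =
    -(w i * ∏ j ∈ Finset.univ.erase i, (x i - x j)) := by
  rw [eval_secularPoly, Finset.prod_eq_zero (Finset.mem_univ i) (sub_self _), zero_sub,
    Finset.sum_eq_single i]
  · intro k _ hk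
    rw [Finset.prod_eq_zero (Finset.mem_erase.2 ⟨hk.symm, Finset.mem_univ i⟩) (sub_self _),
      mul_zero]
  · simp

variable {x w}

/-- Both sides are monic of degree n, so their difference has degree below n and is determined by n
points. -/
theorem prod_X_sub_C_eq_secularPoly {y t : Fin n → ℝ} (ht : Function.Injective t)
    (h : ∀ i, ∏ j, (t i - y j) = (secularPoly x w).eval (t i)) :
    ∏ j, (X - C (y j)) = secularPoly x w := by
  refine eq_of_degree_sub_lt_of_eval_index_eq (v := t) Finset.univ ht.injOn ?_ ?_
  · refine lt_of_lt_of_eq (degree_sub_lt_left ?_ (monic_prod_X_sub_C_fin y).ne_zero ?_) ?_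
    · rw [degree_prod_X_sub_C_fin, degree_secularPoly]
    · rw [(monic_prod_X_sub_C_fin y).leadingCoeff, (monic_secularPoly x w).leadingCoeff]
    · rw [degree_prod_X_sub_C_fin]; simp
  · intro i _
    rw [← h, eval_prod]
    simp

/-- Comparison of the coefficients of X^(n-1). For the rank one perturbation it says that the trace
grows by |v|². -/
theorem sum_eq_of_prod_X_sub_C_eq_secularPoly {y : Fin n → ℝ}
    (h : ∏ j, (X - C (y j)) = secularPoly x w) : ∑ i, w i = ∑ i, y i - ∑ i, x i := by
  cases n with
  | zero => simp
  | succ k =>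
    have hc : ∀ z : Fin (k + 1) → ℝ, (∏ j, (X - C (z j))).coeff k = -∑ j, z j := by
      intro z
      have hdeg : (∏ j, (X - C (z j))).natDegree = k + 1 := by
        rw [natDegree_prod_of_monic _ _ fun _ _ => monic_X_sub_C _]; simp
      rw [← prod_X_sub_C_nextCoeff, nextCoeff_of_natDegree_pos (by rw [hdeg]; omega), hdeg]
      rfl
    have hd : ∀ i : Fin (k + 1),
        (∏ j ∈ Finset.univ.erase i, (X - C (x j))).coeff k = 1 := by
      intro i
      have hm : (∏ j ∈ Finset.univ.erase i, (X - C (x j))).Monic :=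
        monic_prod_of_monic _ _ fun _ _ => monic_X_sub_C _
      have hdeg : (∏ j ∈ Finset.univ.erase i, (X - C (x j))).natDegree = k := by
        rw [natDegree_prod_of_monic _ _ fun _ _ => monic_X_sub_C _]; simp
      rw [← hm.coeff_natDegree, hdeg]
    have := congrArg (fun p => p.coeff k) h
    simp only [secularPoly, coeff_sub, hc, finsetSum_coeff, coeff_C_mul, hd, mul_one] at this
    linarith

theorem neg_one_pow_mul_prod_erase_pos (hx : StrictMono x) (i : Fin n) :
    0 < (-1) ^ (n - 1 - (i : ℕ)) * ∏ j ∈ Finset.univ.erase i, (x i - x j) := by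
  have h : ∏ j ∈ Finset.Ioi i, (x i - x j) =
      (-1) ^ (n - 1 - (i : ℕ)) * ∏ j ∈ Finset.Ioi i, (x j - x i) := by
    rw [← Fin.card_Ioi, ← Finset.prod_const, ← Finset.prod_mul_distrib]
    exact Finset.prod_congr rfl fun j _ => by ring
  rw [prod_erase_eq_prod_Iio_mul_prod_Ioi, h, mul_left_comm, ← mul_assoc _ _ (∏ j ∈ _, _),
    ← mul_pow, neg_one_mul, neg_neg, one_pow, one_mul]
  exact mul_pos (Finset.prod_pos fun j hj => sub_pos.2 (hx (Finset.mem_Iio.1 hj)))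
    (Finset.prod_pos fun j hj => sub_pos.2 (hx (Finset.mem_Ioi.1 hj)))

theorem neg_one_pow_mul_eval_secularPoly_neg (hx : StrictMono x) (hw : ∀ i, 0 < w i) (i : Fin n) :
    (-1) ^ (n - 1 - (i : ℕ)) * (secularPoly x w).eval (x i) < 0 := by
  rw [eval_secularPoly_node, mul_neg, mul_left_comm, neg_lt_zero]
  exact mul_pos (hw i) (neg_one_pow_mul_prod_erase_pos hx i)

/-- The secular polynomial alternates in sign along the nodes, is negative at the last one and tends
to +∞. The intermediate value theorem gives a root after each node and before the next. -/
theorem exists_secularPoly_root (hx : StrictMono x) (hw : ∀ i, 0 < w i) (i : Fin n) :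
    ∃ t, (secularPoly x w).eval t = 0 ∧ x i < t ∧ ∀ j, i < j → t < x j := by
  obtain ⟨b, hib, hbj, hb⟩ : ∃ b, x i < b ∧ (∀ j, i < j → b ≤ x j) ∧
      0 < (-1) ^ (n - 1 - (i : ℕ)) * (secularPoly x w).eval b := by
    by_cases hi : (i : ℕ) + 1 < n
    · have hlt : i < ⟨i + 1, hi⟩ := Fin.lt_def.2 (Nat.lt_succ_self _)
      refine ⟨x ⟨i + 1, hi⟩, hx hlt, fun j hj => hx.monotone (Fin.le_def.2 ?_), ?_⟩
      · exact Nat.succ_le_of_lt (Fin.lt_def.1 hj)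
      · have h1 := neg_one_pow_mul_eval_secularPoly_neg hx hw ⟨i + 1, hi⟩
        have h2 : n - 1 - (i : ℕ) = (n - 1 - (i + 1)) + 1 := by omega
        rw [h2, pow_succ]
        simp only at h1
        linarith
    · have hd : 0 < (secularPoly x w).degree := by
        rw [degree_secularPoly]; exact_mod_cast i.pos
      have ht := (secularPoly x w).tendsto_atTop_of_leadingCoeff_nonneg hd
        (by rw [(monic_secularPoly x w).leadingCoeff]; exact zero_le_one)
      obtain ⟨b, hb1, hb2⟩ :=
        ((ht.eventually_gt_atTop 0).and (Filter.eventually_gt_atTop (x i))).exists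
      refine ⟨b, hb2, fun j hj => ?_, ?_⟩
      · have := Fin.lt_def.1 hj
        have := j.isLt
        omega
      · have h2 : n - 1 - (i : ℕ) = 0 := by omega
        rw [h2, pow_zero, one_mul]
        exact hb1
  have hcont : ContinuousOn (fun t => (-1) ^ (n - 1 - (i : ℕ)) * (secularPoly x w).eval t)
      (Set.Icc (x i) b) := (continuous_const.mul (secularPoly x w).continuous).continuousOn
  obtain ⟨t, ht, h0⟩ := intermediate_value_Ioo hib.le hcont
    ⟨neg_one_pow_mul_eval_secularPoly_neg hx hw i, hb⟩
  refine ⟨t, ?_, ht.1, fun j hj => ht.2.trans_le (hbj j hj)⟩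
  simpa using h0

theorem exists_interlaces_prod_X_sub_C_eq (hx : StrictMono x) (hw : ∀ i, 0 < w i) :
    ∃ y, Interlaces x y ∧ ∏ j, (X - C (y j)) = secularPoly x w := by
  choose y h0 h1 h2 using exists_secularPoly_root hx hw
  have hy : Interlaces x y := ⟨h1, h2⟩
  refine ⟨y, hy, prod_X_sub_C_eq_secularPoly hy.strictMono_right.injective fun i => ?_⟩
  rw [h0, Finset.prod_eq_zero (Finset.mem_univ i) (sub_self _)]

end SecularPoly

/-- The residues `w_i = -∏_j (x_i - y_j) / ∏_{j≠i} (x_i - x_j)`, for which `y` are the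
zeros of the secular function `1 - ∑_i w_i / (X - x_i)`. -/
noncomputable def secularResidue {n : ℕ} (x y : Fin n → ℝ) (i : Fin n) : ℝ :=
  -(∏ j, (x i - y j)) / ∏ j ∈ Finset.univ.erase i, (x i - x j)

/-! ### The change of variables between residues and interlacing roots -/

section SecularResidue

variable {n : ℕ} {x y : Fin n → ℝ}

theorem StrictMono.prod_erase_ne_zero (hx : StrictMono x) (i : Fin n) :
    ∏ j ∈ Finset.univ.erase i, (x i - x j) ≠ 0 :=
  Finset.prod_ne_zero_iff.2 fun _ hj =>
    sub_ne_zero.2 fun h => Finset.ne_of_mem_erase hj (hx.injective h).symm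

theorem prod_X_sub_C_eq_secularPoly_residue (hx : StrictMono x) (y : Fin n → ℝ) :
    ∏ j, (Polynomial.X - Polynomial.C (y j)) = secularPoly x (secularResidue x y) := by
  refine prod_X_sub_C_eq_secularPoly hx.injective fun i => ?_
  rw [eval_secularPoly_node, secularResidue, div_mul_cancel₀ _ (hx.prod_erase_ne_zero i), neg_neg]

/-- The residue is y_i - x_i times the quotients (x_i - y_j)/(x_i - x_j) for j ≠ i. Each quotient is
positive because x_j and y_j lie on the same side of x_i. -/
theorem Interlaces.secularResidue_pos (h : Interlaces x y) (i : Fin n) :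
    0 < secularResidue x y i := by
  rw [secularResidue, ← Finset.mul_prod_erase _ _ (Finset.mem_univ i), ← neg_mul, neg_sub,
    mul_div_assoc, ← Finset.prod_div_distrib]
  refine mul_pos (sub_pos.2 (h.1 i)) (Finset.prod_pos fun j hj => ?_)
  rcases lt_or_gt_of_ne (Finset.ne_of_mem_erase hj) with hji | hij
  · exact div_pos (sub_pos.2 (h.2 j i hji)) (sub_pos.2 (h.strictMono_left hji))
  · exact div_pos_of_neg_of_neg (sub_neg.2 ((h.strictMono_left hij).trans (h.1 j)))
      (sub_neg.2 (h.strictMono_left hij))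

theorem injOn_secularResidue (hx : StrictMono x) :
    Set.InjOn (secularResidue x) {y | Interlaces x y} := by
  intro y hy z hz h
  refine hy.strictMono_right.monotone.eq_of_prod_X_sub_C_eq hz.strictMono_right.monotone ?_
  rw [prod_X_sub_C_eq_secularPoly_residue hx, prod_X_sub_C_eq_secularPoly_residue hx, h]

/-- Surjectivity is the existence of interlacing roots; the weight w_i is recovered by evaluating
the secular polynomial at x_i. -/
theorem image_secularResidue (hx : StrictMono x) :
    secularResidue x '' {y | Interlaces x y} = {w | ∀ i, 0 < w i} := by
  ext w
  constructor
  · rintro ⟨y, hy, rfl⟩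
    exact fun i => hy.secularResidue_pos i
  · intro hw
    obtain ⟨y, hy, h⟩ := exists_interlaces_prod_X_sub_C_eq hx hw
    refine ⟨y, hy, funext fun i => ?_⟩
    have := congrArg (Polynomial.eval (x i)) h
    rw [eval_secularPoly_node, Polynomial.eval_prod] at this
    simp only [Polynomial.eval_sub, Polynomial.eval_X, Polynomial.eval_C] at this
    rw [secularResidue, this, neg_neg, mul_div_cancel_right₀ _ (hx.prod_erase_ne_zero i)]

theorem sum_secularResidue (hx : StrictMono x) (y : Fin n → ℝ) :
    ∑ i, secularResidue x y i = ∑ i, y i - ∑ i, x i :=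
  sum_eq_of_prod_X_sub_C_eq_secularPoly (prod_X_sub_C_eq_secularPoly_residue hx y)

/-- The Jacobian matrix of `secularResidue x`. -/
noncomputable def secularJacobian (x y : Fin n → ℝ) : Matrix (Fin n) (Fin n) ℝ :=
  Matrix.of fun i j => (∏ k ∈ Finset.univ.erase i, (x i - x k))⁻¹ *
    ∏ k ∈ Finset.univ.erase j, (x i - y k)

theorem hasFDerivAt_secularResidue (x y : Fin n → ℝ) :
    HasFDerivAt (secularResidue x)
      (LinearMap.toContinuousLinearMap (Matrix.toLin' (secularJacobian x y))) y := by
  rw [hasFDerivAt_pi']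
  intro i
  have h1 : ∀ j ∈ Finset.univ, HasFDerivAt (fun z : Fin n → ℝ => x i - z j)
      (-ContinuousLinearMap.proj (R := ℝ) (φ := fun _ : Fin n => ℝ) j) y := fun j _ =>
    ((ContinuousLinearMap.proj (R := ℝ) (φ := fun _ : Fin n => ℝ) j).hasFDerivAt).const_sub (x i)
  have h2 := ((HasFDerivAt.finsetProd h1).neg).mul_const
    (∏ j ∈ Finset.univ.erase i, (x i - x j))⁻¹
  have h3 : (fun z => secularResidue x z i) = fun z : Fin n → ℝ =>
      (-(∏ j, (x i - z j))) * (∏ j ∈ Finset.univ.erase i, (x i - x j))⁻¹ := by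
    ext z; rw [secularResidue, div_eq_mul_inv]
  rw [h3]
  refine h2.congr_fderiv ?_
  ext v
  simp [secularJacobian, Matrix.mulVec, dotProduct, Finset.mul_sum, mul_assoc]

/-- Column j holds the values at the x_i of a polynomial of degree below n depending only on y. The
matrix is therefore the Vandermonde matrix of x times a coefficient matrix, whose determinant is c.
-/
theorem exists_det_prod_erase_eq (y : Fin n → ℝ) : ∃ c : ℝ, ∀ x : Fin n → ℝ,
    (Matrix.of fun i j => ∏ k ∈ Finset.univ.erase j, (x i - y k) : Matrix (Fin n) (Fin n) ℝ).det =
      vandermondeProd x * c := by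
  let p : Fin n → Polynomial ℝ := fun j =>
    ∏ k ∈ Finset.univ.erase j, (Polynomial.X - Polynomial.C (y k))
  have hp : ∀ j, (p j).natDegree < n := by
    intro j
    have := j.pos
    rw [Polynomial.natDegree_prod_of_monic _ _ fun _ _ => Polynomial.monic_X_sub_C _]
    simp only [Polynomial.natDegree_X_sub_C, Finset.sum_const,
      Finset.card_erase_of_mem (Finset.mem_univ j), Finset.card_univ, Fintype.card_fin]
    simp only [smul_eq_mul, mul_one]
    omega
  refine ⟨(Matrix.of fun k j : Fin n => (p j).coeff k).det, fun x => ?_⟩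
  rw [← det_vandermonde_eq_vandermondeProd, ← Matrix.det_mul]
  congr 1
  ext i j
  have : ∏ k ∈ Finset.univ.erase j, (x i - y k) = (p j).eval (x i) := by
    simp [p, Polynomial.eval_prod]
  rw [Matrix.of_apply, this, Polynomial.eval_eq_sum_range' (hp j), Finset.sum_range]
  simp [Matrix.mul_apply, mul_comm]

/-- The constant c is found by setting x = y: the matrix becomes diagonal with determinant ±Δ(y)²,
so |c| = Δ(y). -/
theorem abs_det_prod_erase_eq (x : Fin n → ℝ) (hy : StrictMono y) :
    |(Matrix.of fun i j => ∏ k ∈ Finset.univ.erase j, (x i - y k) :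
      Matrix (Fin n) (Fin n) ℝ).det| = |vandermondeProd x| * vandermondeProd y := by
  obtain ⟨c, hc⟩ := exists_det_prod_erase_eq y
  have hd : (Matrix.of fun i j => ∏ k ∈ Finset.univ.erase j, (y i - y k) :
      Matrix (Fin n) (Fin n) ℝ) =
      Matrix.diagonal fun i => ∏ k ∈ Finset.univ.erase i, (y i - y k) := by
    ext i j
    by_cases hij : i = j
    · subst hij; simp
    · rw [Matrix.diagonal_apply_ne _ hij, Matrix.of_apply]
      exact Finset.prod_eq_zero (Finset.mem_erase.2 ⟨hij, Finset.mem_univ i⟩) (sub_self _)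
  have h := hc y
  rw [hd, Matrix.det_diagonal] at h
  have h2 := abs_prod_prod_erase_eq_sq y
  have hpos := hy.vandermondeProd_pos
  rw [h, abs_mul, abs_of_pos hpos, sq] at h2
  rw [hc x, abs_mul, mul_left_cancel₀ hpos.ne' h2]

/-- The row factors contribute Δ(x)⁻² and the remaining determinant Δ(x) Δ(y), up to sign. -/
theorem abs_det_secularJacobian (hx : StrictMono x) (hy : StrictMono y) :
    |(secularJacobian x y).det| = vandermondeProd y / vandermondeProd x := by
  have hpos := hx.vandermondeProd_pos
  have h := Matrix.det_mul_column (fun i => (∏ k ∈ Finset.univ.erase i, (x i - x k))⁻¹)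
    (Matrix.of fun i j => ∏ k ∈ Finset.univ.erase j, (x i - y k))
  rw [secularJacobian]
  simp only [Matrix.of_apply] at h
  rw [h, abs_mul, abs_det_prod_erase_eq x hy, Finset.prod_inv_distrib, abs_inv,
    abs_prod_prod_erase_eq_sq, abs_of_pos hpos]
  field_simp

theorem measurableSet_interlaces :
    MeasurableSet {p : (Fin n → ℝ) × (Fin n → ℝ) | Interlaces p.1 p.2} := by
  have : {p : (Fin n → ℝ) × (Fin n → ℝ) | Interlaces p.1 p.2} =
      (⋂ i, {p | p.1 i < p.2 i}) ∩ ⋂ i, ⋂ j, ⋂ (_ : i < j), {p | p.2 i < p.1 j} := by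
    ext p; simp [Interlaces]
  rw [this]
  refine (MeasurableSet.iInter fun i => measurableSet_lt (by fun_prop) (by fun_prop)).inter
    (MeasurableSet.iInter fun i => MeasurableSet.iInter fun j => MeasurableSet.iInter fun _ =>
      measurableSet_lt (by fun_prop) (by fun_prop))

/-- Change of variables from residues to zeros of the secular function. -/
theorem lintegral_pos_eq_lintegral_interlaces (hx : StrictMono x) (g : (Fin n → ℝ) → ℝ≥0∞) :
    ∫⁻ w in {w : Fin n → ℝ | ∀ i, 0 < w i}, g w =
      ∫⁻ y in {y | Interlaces x y},
        ENNReal.ofReal (vandermondeProd y / vandermondeProd x) * g (secularResidue x y) := by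
  have hm : MeasurableSet {y | Interlaces x y} :=
    measurableSet_interlaces.preimage measurable_prodMk_left
  rw [← image_secularResidue hx, lintegral_image_eq_lintegral_abs_det_fderiv_mul volume hm
    (fun y _ => (hasFDerivAt_secularResidue x y).hasFDerivWithinAt) (injOn_secularResidue hx)]
  refine setLIntegral_congr_fun hm fun y hy => ?_
  simp only [ContinuousLinearMap.det]
  rw [← abs_det_secularJacobian hx (Interlaces.strictMono_right hy)]
  congr 3
  exact LinearMap.det_toLin' _

end SecularResidue

/-! ### Rank one perturbations of Hermitian matrices by Gaussian vectors -/

section RankOne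

variable {n : ℕ}

theorem Matrix.IsHermitian.add_vecMulVec_star {A : Matrix (Fin n) (Fin n) ℂ} (hA : A.IsHermitian)
    (v : Fin n → ℂ) : (A + Matrix.vecMulVec (star v) v).IsHermitian := by
  refine hA.add ?_
  ext i j
  simp [Matrix.vecMulVec, mul_comm]

theorem isHermitian_diagonal_ofReal (x : Fin n → ℝ) :
    (Matrix.diagonal fun i => (x i : ℂ)).IsHermitian := by
  rw [Matrix.isHermitian_diagonal_iff]
  intro i
  simp [isSelfAdjoint_iff]

/-- For real t outside the x_i the diagonal part is invertible, and the matrix determinant lemma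
gives ∏ (t - x_i) · (1 - Σ |v_i|²/(t - x_i)). Infinitely many such t suffice, and the x_i need not
be distinct. -/
theorem charpoly_diagonal_add_vecMulVec (x : Fin n → ℝ) (v : Fin n → ℂ) :
    (Matrix.diagonal (fun i => (x i : ℂ)) + Matrix.vecMulVec (star v) v).charpoly =
      (secularPoly x fun i => Complex.normSq (v i)).map Complex.ofRealHom := by
  refine Polynomial.eq_of_infinite_eval_eq _ _ (Set.Infinite.mono
    (s := ((↑) : ℝ → ℂ) '' (Set.range x)ᶜ) ?_
    ((Set.Infinite.image Complex.ofReal_injective.injOn (Set.finite_range x).infinite_compl)))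
  rintro _ ⟨t, ht, rfl⟩
  have hne : ∀ i, t - x i ≠ 0 := fun i h => ht ⟨i, by linarith⟩
  have hne' : ∀ i, (t : ℂ) - x i ≠ 0 := fun i => by exact_mod_cast hne i
  have h1 : Matrix.scalar (Fin n) (t : ℂ) -
      (Matrix.diagonal (fun i => (x i : ℂ)) + Matrix.vecMulVec (star v) v) =
      Matrix.diagonal (fun i => (t : ℂ) - x i) +
        Matrix.replicateCol Unit (-star v) * Matrix.replicateRow Unit v := by
    ext i j
    by_cases hij : i = j <;>
      simp [hij, Matrix.vecMulVec, Matrix.mul_apply]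
    ring
  have hdet : (Matrix.diagonal (fun i => (t : ℂ) - x i)).det = ∏ i, ((t : ℂ) - x i) :=
    Matrix.det_diagonal
  have hinv : (Matrix.diagonal (fun i => (t : ℂ) - x i))⁻¹ =
      Matrix.diagonal fun i => ((t : ℂ) - x i)⁻¹ := by
    refine Matrix.inv_eq_right_inv ?_
    rw [Matrix.diagonal_mul_diagonal, ← Matrix.diagonal_one]
    congr 1
    ext i
    exact mul_inv_cancel₀ (hne' i)
  rw [Set.mem_ofPred_eq, Matrix.eval_charpoly, h1, Matrix.det_add_replicateCol_mul_replicateRow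
    (by rw [hdet, isUnit_iff_ne_zero]; exact Finset.prod_ne_zero_iff.2 fun i _ => hne' i), hdet,
    hinv, Matrix.det_unique]
  have h2 : Polynomial.eval (t : ℂ) ((secularPoly x fun i => Complex.normSq (v i)).map
      Complex.ofRealHom) =
      ((Polynomial.eval t (secularPoly x fun i => Complex.normSq (v i)) : ℝ) : ℂ) := by
    rw [Polynomial.eval_map]
    exact Polynomial.eval₂_at_apply Complex.ofRealHom t
  have h3 : (Matrix.replicateRow Unit v * Matrix.diagonal (fun i => ((t : ℂ) - x i)⁻¹) *
      Matrix.replicateCol Unit (-star v)) default default =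
      ∑ i, -(v i * ((t : ℂ) - x i)⁻¹ * star (v i)) := by
    rw [Matrix.mul_apply]
    simp [Matrix.mul_diagonal]
  rw [h2, eval_secularPoly, Matrix.add_apply, Matrix.one_apply_eq, h3]
  push_cast
  rw [mul_add, mul_one, Finset.mul_sum, sub_eq_add_neg, ← Finset.sum_neg_distrib]
  congr 1
  refine Finset.sum_congr rfl fun i _ => ?_
  rw [← Finset.mul_prod_erase _ _ (Finset.mem_univ i), Complex.normSq_eq_conj_mul_self]
  have := hne' i
  field_simp
  simp [mul_comm]

theorem orderedSpectrum_diagonal_add_vecMulVec {x y : Fin n → ℝ} (h : Interlaces x y)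
    {v : Fin n → ℂ} (hv : ∀ i, Complex.normSq (v i) = secularResidue x y i) :
    orderedSpectrum (Matrix.diagonal (fun i => (x i : ℂ)) + Matrix.vecMulVec (star v) v) = y := by
  refine orderedSpectrum_eq_of_charpoly
    ((isHermitian_diagonal_ofReal x).add_vecMulVec_star v) h.strictMono_right.monotone ?_
  rw [charpoly_diagonal_add_vecMulVec, funext hv,
    ← prod_X_sub_C_eq_secularPoly_residue h.strictMono_left]
  simp [Polynomial.map_prod]

theorem measurable_orderedSpectrum_add_vecMulVec {α : Type*} [MeasurableSpace α]
    {f : α → Matrix (Fin n) (Fin n) ℂ} (hf : ∀ i j, Measurable fun a => f a i j)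
    (hH : ∀ a, (f a).IsHermitian) {v : α → Fin n → ℂ} (hv : Measurable v) :
    Measurable fun a => orderedSpectrum (f a + Matrix.vecMulVec (star (v a)) (v a)) := by
  refine measurable_orderedSpectrum (fun i j => ?_) fun a => (hH a).add_vecMulVec_star _
  have hvi : ∀ i, Measurable fun a => v a i := fun i => (measurable_pi_apply i).comp hv
  simp only [Matrix.add_apply, Matrix.vecMulVec_apply, Pi.star_apply]
  exact (hf i j).add ((continuous_star.measurable.comp (hvi i)).mul (hvi j))

theorem measurable_diagonal_ofReal_apply {α : Type*} [MeasurableSpace α] {x : α → Fin n → ℝ}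
    (hx : Measurable x) (i j : Fin n) :
    Measurable fun a => (Matrix.diagonal (fun k => (x a k : ℂ)) : Matrix (Fin n) (Fin n) ℂ) i j := by
  by_cases hij : i = j
  · subst hij
    simp only [Matrix.diagonal_apply_eq]
    exact Complex.measurable_ofReal.comp ((measurable_pi_apply i).comp hx)
  · simp only [Matrix.diagonal_apply_ne _ hij]
    exact measurable_const

/-- The density of the eigenvalues of a Gaussian rank one perturbation of a diagonal matrix. -/
theorem lintegral_orderedSpectrum_diagonal_add {x : Fin n → ℝ} (hx : StrictMono x)
    {g : (Fin n → ℝ) → ℝ≥0∞} (hg : Measurable g) :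
    ∫⁻ v, g (orderedSpectrum (Matrix.diagonal (fun i => (x i : ℂ)) +
        Matrix.vecMulVec (star v) v)) ∂(Measure.pi fun _ : Fin n => complexGaussian) =
      ∫⁻ y in {y | Interlaces x y}, ENNReal.ofReal
        (vandermondeProd y / vandermondeProd x * Real.exp (-(∑ i, y i - ∑ i, x i))) * g y := by
  -- The spectrum depends on v only through the |v_i|², so v may be replaced by the real vector with
  -- entries |v_i|. This turns the integrand into a function `G` of the exponential variables w_i.
  let V : (Fin n → ℝ) → Fin n → ℂ := fun w i => (√(w i) : ℝ)
  let G : (Fin n → ℝ) → ℝ≥0∞ := fun w => g (orderedSpectrum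
    (Matrix.diagonal (fun i => (x i : ℂ)) + Matrix.vecMulVec (star (V w)) (V w)))
  have hV : Measurable V := measurable_pi_lambda _ fun i => Complex.measurable_ofReal.comp
    (Real.continuous_sqrt.measurable.comp (measurable_pi_apply i))
  have hVsq : ∀ w : Fin n → ℝ, ∀ i, 0 ≤ w i → Complex.normSq (V w i) = w i := fun w i hi => by
    simp [V, Complex.normSq_ofReal, Real.mul_self_sqrt hi]
  have hG : Measurable G := hg.comp (measurable_orderedSpectrum_add_vecMulVec
    (f := fun _ => Matrix.diagonal fun i => (x i : ℂ)) (fun _ _ => measurable_const) (fun _ => isHermitian_diagonal_ofReal x) hV)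
  have hns : Measurable fun (v : Fin n → ℂ) i => Complex.normSq (v i) :=
    measurable_pi_lambda _ fun i =>
      Complex.continuous_normSq.measurable.comp (measurable_pi_apply i)
  have h1 : ∀ v : Fin n → ℂ, g (orderedSpectrum (Matrix.diagonal (fun i => (x i : ℂ)) +
        Matrix.vecMulVec (star v) v)) = G fun i => Complex.normSq (v i) := by
    intro v
    refine congrArg g (orderedSpectrum_congr ((isHermitian_diagonal_ofReal x).add_vecMulVec_star _)
      ((isHermitian_diagonal_ofReal x).add_vecMulVec_star _) ?_)
    rw [charpoly_diagonal_add_vecMulVec, charpoly_diagonal_add_vecMulVec]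
    congr 2
    ext i
    exact (hVsq (fun i => Complex.normSq (v i)) i (Complex.normSq_nonneg _)).symm
  have hm : MeasurableSet {y | Interlaces x y} :=
    measurableSet_interlaces.preimage measurable_prodMk_left
  simp_rw [h1]
  rw [← lintegral_map hG hns, map_normSq_pi_complexGaussian,
    lintegral_withDensity_eq_lintegral_mul _ (by fun_prop) hG,
    lintegral_pos_eq_lintegral_interlaces hx]
  refine setLIntegral_congr_fun hm fun y hy => ?_
  have hy' : Interlaces x y := hy
  have h2 : G (secularResidue x y) = g y := congrArg g (orderedSpectrum_diagonal_add_vecMulVec hy'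
    fun i => hVsq _ i (hy'.secularResidue_pos i).le)
  simp only [Pi.mul_apply]
  rw [h2, sum_secularResidue hx, ← mul_assoc, ← ENNReal.ofReal_mul
    (div_nonneg hy'.strictMono_right.vandermondeProd_pos.le hx.vandermondeProd_pos.le)]

theorem sum_normSq_eq_star_dotProduct (v : Fin n → ℂ) :
    ((∑ i, Complex.normSq (v i) : ℝ) : ℂ) = star v ⬝ᵥ v := by
  simp [dotProduct, Complex.normSq_eq_conj_mul_self]

theorem sum_normSq_vecMul {U : Matrix (Fin n) (Fin n) ℂ} (hU : U * U.conjTranspose = 1)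
    (v : Fin n → ℂ) :
    ∑ i, Complex.normSq (Matrix.vecMul v U i) = ∑ i, Complex.normSq (v i) := by
  have h : ((∑ i, Complex.normSq (Matrix.vecMul v U i) : ℝ) : ℂ) =
      ((∑ i, Complex.normSq (v i) : ℝ) : ℂ) := by
    rw [sum_normSq_eq_star_dotProduct, sum_normSq_eq_star_dotProduct, Matrix.star_vecMul,
      dotProduct_comm, ← Matrix.dotProduct_mulVec, Matrix.mulVec_mulVec, hU, Matrix.one_mulVec,
      dotProduct_comm]
  exact_mod_cast h

theorem exists_orderedSpectrum_eq_eigenvalues_comp {A : Matrix (Fin n) (Fin n) ℂ}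
    (hA : A.IsHermitian) : ∃ e : Equiv.Perm (Fin n), orderedSpectrum A = hA.eigenvalues ∘ e := by
  refine ⟨(Fin.revPerm.trans (finCongr (Fintype.card_fin n).symm)).trans
    (Fintype.equivOfCardEq (Fintype.card_fin _)), ?_⟩
  ext i
  simp [orderedSpectrum, hA, Matrix.IsHermitian.eigenvalues]

open scoped ComplexOrder in
theorem orderedSpectrum_conjTranspose_mul_self_nonneg {m : ℕ} (B : Matrix (Fin m) (Fin n) ℂ)
    (i : Fin n) : 0 ≤ orderedSpectrum (B.conjTranspose * B) i := by
  have hps := Matrix.posSemidef_conjTranspose_mul_self B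
  obtain ⟨e, he⟩ := exists_orderedSpectrum_eq_eigenvalues_comp hps.1
  rw [he]
  exact hps.eigenvalues_nonneg _

/-- A Hermitian matrix is diagonalised, with ordered eigenvalues, by an isometry. -/
theorem exists_linearEquiv_charpoly_add_vecMulVec {A : Matrix (Fin n) (Fin n) ℂ}
    (hA : A.IsHermitian) : ∃ L : (Fin n → ℂ) ≃ₗ[ℂ] (Fin n → ℂ),
      (∀ v, ∑ i, Complex.normSq (L v i) = ∑ i, Complex.normSq (v i)) ∧
      ∀ v, (A + Matrix.vecMulVec (star v) v).charpoly =
        (Matrix.diagonal (fun i => (orderedSpectrum A i : ℂ)) +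
          Matrix.vecMulVec (star (L v)) (L v)).charpoly := by
  obtain ⟨e, he⟩ := exists_orderedSpectrum_eq_eigenvalues_comp hA
  let U : Matrix (Fin n) (Fin n) ℂ := hA.eigenvectorUnitary
  have hU : U * U.conjTranspose = 1 := (Matrix.mem_unitaryGroup_iff).1 hA.eigenvectorUnitary.2
  have hU' : U.conjTranspose * U = 1 := (Matrix.mem_unitaryGroup_iff').1 hA.eigenvectorUnitary.2
  have hspec : A = U * Matrix.diagonal (fun i => (hA.eigenvalues i : ℂ)) * U.conjTranspose := by
    conv_lhs => rw [hA.spectral_theorem, Unitary.conjStarAlgAut_apply]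
    rfl
  -- Conjugation by the eigenvector matrix U turns v*v into (vU)*(vU); the permutation e then puts
  -- the eigenvalues in increasing order.
  let f : (Fin n → ℂ) →ₗ[ℂ] (Fin n → ℂ) :=
    (LinearMap.funLeft ℂ ℂ e).comp (Matrix.vecMulLinear U)
  have hfv : ∀ v, f v = Matrix.vecMul v U ∘ e := fun v => rfl
  have hf : ∀ v, ∑ i, Complex.normSq (f v i) = ∑ i, Complex.normSq (v i) := by
    intro v
    rw [← sum_normSq_vecMul hU v, hfv]
    exact Equiv.sum_comp e fun i => Complex.normSq (Matrix.vecMul v U i)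
  have hinj : Function.Injective f := by
    rw [injective_iff_map_eq_zero]
    intro v hv
    have h0 := hf v
    rw [hv] at h0
    have h1 : ∑ i, Complex.normSq (v i) = 0 := by rw [← h0]; simp
    rw [Finset.sum_eq_zero_iff_of_nonneg fun i _ => Complex.normSq_nonneg _] at h1
    ext i
    exact Complex.normSq_eq_zero.1 (h1 i (Finset.mem_univ i))
  refine ⟨LinearEquiv.ofInjectiveEndo f hinj, fun v => hf v, fun v => ?_⟩
  have h1 : A + Matrix.vecMulVec (star v) v =
      U * (Matrix.diagonal (fun i => (hA.eigenvalues i : ℂ)) +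
        Matrix.vecMulVec (star (Matrix.vecMul v U)) (Matrix.vecMul v U)) * U.conjTranspose := by
    rw [mul_add, add_mul, ← hspec, Matrix.mul_vecMulVec, Matrix.vecMulVec_mul,
      Matrix.star_vecMul, Matrix.mulVec_mulVec, hU, Matrix.one_mulVec, Matrix.vecMul_vecMul, hU,
      Matrix.vecMul_one]
  have h2 : Matrix.diagonal (fun i => (orderedSpectrum A i : ℂ)) +
      Matrix.vecMulVec (star (f v)) (f v) =
      Matrix.reindex e.symm e.symm (Matrix.diagonal (fun i => (hA.eigenvalues i : ℂ)) +
        Matrix.vecMulVec (star (Matrix.vecMul v U)) (Matrix.vecMul v U)) := by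
    ext i j
    simp [hfv, he, Matrix.vecMulVec_apply, Matrix.diagonal_apply]
  rw [LinearEquiv.coe_ofInjectiveEndo, h2, Matrix.charpoly_reindex, h1, Matrix.charpoly_mul_comm,
    ← mul_assoc, hU', one_mul]

/-- Unitary invariance of the Gaussian law: the effect of the perturbation depends on A only through
its spectrum. -/
theorem lintegral_orderedSpectrum_add_vecMulVec {A : Matrix (Fin n) (Fin n) ℂ}
    (hA : A.IsHermitian) {g : (Fin n → ℝ) → ℝ≥0∞} (hg : Measurable g) :
    ∫⁻ v, g (orderedSpectrum (A + Matrix.vecMulVec (star v) v))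
        ∂(Measure.pi fun _ : Fin n => complexGaussian) =
      ∫⁻ v, g (orderedSpectrum (Matrix.diagonal (fun i => (orderedSpectrum A i : ℂ)) +
        Matrix.vecMulVec (star v) v)) ∂(Measure.pi fun _ : Fin n => complexGaussian) := by
  obtain ⟨L, hL, h⟩ := exists_linearEquiv_charpoly_add_vecMulVec hA
  have hdiag := isHermitian_diagonal_ofReal (orderedSpectrum A)
  have h1 : ∀ v, orderedSpectrum (A + Matrix.vecMulVec (star v) v) =
      orderedSpectrum (Matrix.diagonal (fun i => (orderedSpectrum A i : ℂ)) +
        Matrix.vecMulVec (star (L v)) (L v)) := fun v =>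
    orderedSpectrum_congr (hA.add_vecMulVec_star v) (hdiag.add_vecMulVec_star _) (h v)
  simp_rw [h1]
  exact (measurePreserving_pi_complexGaussian L hL).lintegral_comp
    (hg.comp (measurable_orderedSpectrum_add_vecMulVec
      (f := fun _ => Matrix.diagonal fun i => (orderedSpectrum A i : ℂ))
      (fun _ _ => measurable_const) (fun _ => hdiag) measurable_id))

end RankOne

/-! ### Integrals of Vandermonde products over interlacing boxes -/

section Box

variable {n : ℕ}

theorem prod_pow_mul_vandermondeProd (ν : ℕ) (x : Fin n → ℝ) :
    (∏ i, x i ^ ν) * vandermondeProd x =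
      (Matrix.of fun i j : Fin n => x i ^ (ν + (j : ℕ))).det := by
  rw [← det_vandermonde_eq_vandermondeProd, ← Matrix.det_mul_column]
  congr 1
  ext i j
  simp [pow_add]

theorem integrable_pi_restrict_Ioo_prod_pow (e : Fin n → ℕ) (a b : Fin n → ℝ) :
    Integrable (fun x : Fin n → ℝ => ∏ i, x i ^ e i)
      (Measure.pi fun i => volume.restrict (Set.Ioo (a i) (b i))) := by
  refine Integrable.fintype_prod (f := fun i t => t ^ e i) fun i => ?_
  exact ((continuous_pow (e i)).integrableOn_Icc (a := a i) (b := b i)).mono_set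
    Set.Ioo_subset_Icc_self

theorem integral_pi_restrict_Ioo_prod_pow (e : Fin n → ℕ) {a b : Fin n → ℝ} (hab : a ≤ b) :
    ∫ x : Fin n → ℝ, ∏ i, x i ^ e i ∂(Measure.pi fun i => volume.restrict (Set.Ioo (a i) (b i))) =
      ∏ i, (b i ^ (e i + 1) - a i ^ (e i + 1)) / (e i + 1) := by
  rw [integral_fintype_prod_eq_prod (f := fun i t => t ^ e i)]
  refine Finset.prod_congr rfl fun i _ => ?_
  rw [← integral_Ioc_eq_integral_Ioo, ← intervalIntegral.integral_of_le (hab i), integral_pow]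

theorem prod_pow_mul_vandermondeProd_eq_sum (ν : ℕ) (x : Fin n → ℝ) :
    (∏ i, x i ^ ν) * vandermondeProd x =
      ∑ σ : Equiv.Perm (Fin n), ((Equiv.Perm.sign σ : ℤ) : ℝ) * ∏ i, x i ^ (ν + (σ i : ℕ)) := by
  rw [prod_pow_mul_vandermondeProd, ← Matrix.det_transpose, Matrix.det_apply']
  rfl

theorem integrable_pi_restrict_Ioo_vandermondeProd (ν : ℕ) (a b : Fin n → ℝ) :
    Integrable (fun x : Fin n → ℝ => (∏ i, x i ^ ν) * vandermondeProd x)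
      (Measure.pi fun i => volume.restrict (Set.Ioo (a i) (b i))) := by
  simp_rw [prod_pow_mul_vandermondeProd_eq_sum]
  exact integrable_finsetSum _ fun σ _ =>
    (integrable_pi_restrict_Ioo_prod_pow (fun i => ν + (σ i : ℕ)) a b).const_mul _

/-- The integrand is a determinant whose i-th row depends on x_i alone, so it may be integrated row
by row. -/
theorem integral_pi_restrict_Ioo_vandermondeProd (ν : ℕ) {a b : Fin n → ℝ} (hab : a ≤ b) :
    ∫ x : Fin n → ℝ, (∏ i, x i ^ ν) * vandermondeProd x
        ∂(Measure.pi fun i => volume.restrict (Set.Ioo (a i) (b i))) =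
      (Matrix.of fun i j : Fin n => (b i ^ (ν + (j : ℕ) + 1) - a i ^ (ν + (j : ℕ) + 1)) /
        ((ν + (j : ℕ) : ℕ) + 1 : ℝ)).det := by
  simp_rw [prod_pow_mul_vandermondeProd_eq_sum]
  rw [integral_finsetSum _ fun σ _ =>
    (integrable_pi_restrict_Ioo_prod_pow (fun i => ν + (σ i : ℕ)) a b).const_mul _,
    ← Matrix.det_transpose, Matrix.det_apply']
  refine Finset.sum_congr rfl fun σ _ => ?_
  rw [integral_const_mul, integral_pi_restrict_Ioo_prod_pow (fun i => ν + (σ i : ℕ)) hab]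
  rfl

/-- The intervals lie one after another on the positive axis, so points of the box are increasing
and the integrand is nonnegative. -/
theorem lintegral_box_vandermondeProd (ν : ℕ) {a b : Fin n → ℝ} (hab : a ≤ b)
    (h0 : ∀ i, 0 ≤ a i) (hba : ∀ i j, i < j → b i ≤ a j) :
    ∫⁻ x in Set.univ.pi fun i => Set.Ioo (a i) (b i),
        ENNReal.ofReal ((∏ i, x i ^ ν) * vandermondeProd x) =
      ENNReal.ofReal (Matrix.of fun i j : Fin n =>
        (b i ^ (ν + (j : ℕ) + 1) - a i ^ (ν + (j : ℕ) + 1)) /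
          ((ν + (j : ℕ) : ℕ) + 1 : ℝ)).det := by
  have hm : MeasurableSet (Set.univ.pi fun i => Set.Ioo (a i) (b i)) :=
    MeasurableSet.univ_pi fun _ => measurableSet_Ioo
  have hnn : 0 ≤ᵐ[volume.restrict (Set.univ.pi fun i => Set.Ioo (a i) (b i))]
      fun x : Fin n → ℝ => (∏ i, x i ^ ν) * vandermondeProd x := by
    refine (ae_restrict_iff' hm).2 (Filter.Eventually.of_forall fun x hx => ?_)
    have hx' : ∀ i, a i < x i ∧ x i < b i := fun i => hx i trivial
    have hmono : StrictMono x := fun i j hij =>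
      (hx' i).2.trans_le ((hba i j hij).trans (hx' j).1.le)
    exact mul_nonneg (Finset.prod_nonneg fun i _ => pow_nonneg ((h0 i).trans (hx' i).1.le) _)
      hmono.vandermondeProd_pos.le
  rw [← integral_pi_restrict_Ioo_vandermondeProd ν hab]
  rw [volume_pi, Measure.restrict_pi_pi] at hnn ⊢
  exact (ofReal_integral_eq_lintegral_ofReal
    (integrable_pi_restrict_Ioo_vandermondeProd ν a b) hnn).symm

end Box

/-! ### Evaluation of the box determinants by row operations -/

section Determinants

variable {k : ℕ}

theorem det_pow_div_eq (ν : ℕ) {n : ℕ} (y : Fin n → ℝ) :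
    (Matrix.of fun i j : Fin n => y i ^ (ν + (j : ℕ) + 1) / ((ν + (j : ℕ) : ℕ) + 1 : ℝ)).det =
      (∏ j : Fin n, ((ν + (j : ℕ) : ℕ) + 1 : ℝ)⁻¹) *
        ((∏ i, y i ^ (ν + 1)) * vandermondeProd y) := by
  rw [prod_pow_mul_vandermondeProd, ← Matrix.det_mul_row]
  congr 1
  ext i j
  simp only [Matrix.of_apply]
  rw [div_eq_inv_mul]
  congr 2
  omega

/-- Adding rows cumulatively telescopes the differences. The first lower endpoint is 0, so nothing
remains of the lower endpoints. -/
theorem det_sub_cons_zero_eq (ν : ℕ) (y : Fin (k + 1) → ℝ) :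
    (Matrix.of fun i j : Fin (k + 1) => (y i ^ (ν + (j : ℕ) + 1) -
        (Fin.cons 0 (fun l : Fin k => y l.castSucc) : Fin (k + 1) → ℝ) i ^ (ν + (j : ℕ) + 1)) /
          ((ν + (j : ℕ) : ℕ) + 1 : ℝ)).det =
      (∏ j : Fin (k + 1), ((ν + (j : ℕ) : ℕ) + 1 : ℝ)⁻¹) *
        ((∏ i, y i ^ (ν + 1)) * vandermondeProd y) := by
  rw [← det_pow_div_eq]
  symm
  refine Matrix.det_eq_of_forall_row_eq_smul_add_pred (fun _ => 1) (fun j => ?_) fun i j => ?_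
  · simp
  · simp only [Matrix.of_apply, Fin.cons_succ]
    ring

/-- Subtracting from each row of the Vandermonde matrix of y its predecessor clears the column of
ones except at the top; expansion along that column leaves the k × k determinant of differences. -/
theorem det_sub_pred_eq (y : Fin (k + 1) → ℝ) :
    (Matrix.of fun i j : Fin k => (y i.succ ^ (0 + (j : ℕ) + 1) -
        y i.castSucc ^ (0 + (j : ℕ) + 1)) / ((0 + (j : ℕ) : ℕ) + 1 : ℝ)).det =
      (∏ j : Fin k, ((0 + (j : ℕ) : ℕ) + 1 : ℝ)⁻¹) * vandermondeProd y := by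
  let B : Matrix (Fin (k + 1)) (Fin (k + 1)) ℝ := Matrix.of fun i j =>
    (Fin.cons (y 0 ^ (j : ℕ)) (fun l : Fin k => y l.succ ^ (j : ℕ) - y l.castSucc ^ (j : ℕ)) :
      Fin (k + 1) → ℝ) i
  have hB : (Matrix.vandermonde y).det = B.det := by
    refine Matrix.det_eq_of_forall_row_eq_smul_add_pred (fun _ => 1) (fun j => ?_) fun i j => ?_
    · simp [B]
    · simp [B]
  have hB' : B.det = (Matrix.of fun i j : Fin k =>
      y i.succ ^ ((j : ℕ) + 1) - y i.castSucc ^ ((j : ℕ) + 1)).det := by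
    rw [Matrix.det_succ_column_zero, Fin.sum_univ_succ, Finset.sum_eq_zero]
    · simp only [B, Matrix.of_apply, Fin.cons_zero, Fin.val_zero, pow_zero, add_zero, one_mul]
      congr 1
    · intro i _
      simp [B]
  rw [← det_vandermonde_eq_vandermondeProd, hB, hB', ← Matrix.det_mul_row]
  congr 1
  ext i j
  simp only [Matrix.of_apply, zero_add]
  rw [div_eq_inv_mul]

/-- Integration over the sequences `0 < x₀ < y₀ < x₁ < ⋯ < y_k`. -/
theorem lintegral_interlaces_vandermondeProd (ν : ℕ) {y : Fin (k + 1) → ℝ} (hy0 : ∀ i, 0 < y i)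
    (hy : StrictMono y) :
    ∫⁻ x in {x : Fin (k + 1) → ℝ | (∀ i, 0 < x i) ∧ Interlaces x y},
        ENNReal.ofReal ((∏ i, x i ^ ν) * vandermondeProd x) =
      ENNReal.ofReal ((∏ j : Fin (k + 1), ((ν + (j : ℕ) : ℕ) + 1 : ℝ)⁻¹) *
        ((∏ i, y i ^ (ν + 1)) * vandermondeProd y)) := by
  -- The lower endpoint for x_i is y_(i-1), and 0 when i = 0.
  set z : Fin (k + 1) → ℝ := Fin.cons 0 (fun l : Fin k => y l.castSucc) with hz
  have hz0 : z 0 = 0 := rfl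
  have hzs : ∀ i : Fin k, z i.succ = y i.castSucc := fun i => rfl
  have hset : {x : Fin (k + 1) → ℝ | (∀ i, 0 < x i) ∧ Interlaces x y} =
      Set.univ.pi fun i => Set.Ioo (z i) (y i) := by
    ext x
    simp only [Set.mem_pi, Set.mem_univ, forall_const, Set.mem_Ioo]
    constructor
    · rintro ⟨h0, h1, h2⟩ i
      refine ⟨?_, h1 i⟩
      induction i using Fin.cases with
      | zero => exact h0 0
      | succ i => exact h2 _ _ Fin.castSucc_lt_succ
    · intro h
      have h2 : ∀ i j, i < j → y i < x j := by
        intro i j hij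
        induction j using Fin.cases with
        | zero => exact absurd hij (Fin.not_lt_zero i)
        | succ j =>
          refine lt_of_le_of_lt (hy.monotone ?_) (h j.succ).1
          exact Fin.le_castSucc_iff.2 hij
      refine ⟨fun i => ?_, fun i => (h i).2, h2⟩
      induction i using Fin.cases with
      | zero => exact (h 0).1
      | succ i => exact (hy0 _).trans (h2 0 i.succ (Fin.succ_pos i))
  rw [hset, lintegral_box_vandermondeProd ν, det_sub_cons_zero_eq]
  · intro i
    induction i using Fin.cases with
    | zero => exact (hy0 0).le
    | succ i => exact (hy Fin.castSucc_lt_succ).le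
  · intro i
    induction i using Fin.cases with
    | zero => exact le_rfl
    | succ i => exact (hy0 _).le
  · intro i j hij
    induction j using Fin.cases with
    | zero => exact absurd hij (Fin.not_lt_zero i)
    | succ j => exact hy.monotone (Fin.le_castSucc_iff.2 hij)

/-- Integration over the sequences `0 < y₀ < x₀ < y₁ < ⋯ < x_{k-1} < y_k`. -/
theorem lintegral_interlaces_cons_vandermondeProd {y : Fin (k + 1) → ℝ} (hy0 : ∀ i, 0 < y i)
    (hy : StrictMono y) :
    ∫⁻ x in {x : Fin k → ℝ | (∀ i, 0 < x i) ∧ Interlaces (Fin.cons 0 x : Fin (k + 1) → ℝ) y},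
        ENNReal.ofReal (vandermondeProd x) =
      ENNReal.ofReal ((∏ j : Fin k, ((0 + (j : ℕ) : ℕ) + 1 : ℝ)⁻¹) * vandermondeProd y) := by
  have hset : {x : Fin k → ℝ | (∀ i, 0 < x i) ∧
      Interlaces (Fin.cons 0 x : Fin (k + 1) → ℝ) y} =
      Set.univ.pi fun i => Set.Ioo (y i.castSucc) (y i.succ) := by
    ext x
    simp only [Set.mem_pi, Set.mem_univ, forall_const, Set.mem_Ioo]
    constructor
    · rintro ⟨h0, h1, h2⟩ i
      exact ⟨h2 i.castSucc i.succ Fin.castSucc_lt_succ, h1 i.succ⟩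
    · intro h
      refine ⟨fun i => (hy0 _).trans (h i).1, fun i => ?_, fun i j hij => ?_⟩
      · induction i using Fin.cases with
        | zero => exact hy0 0
        | succ i => exact (h i).2
      · induction j using Fin.cases with
        | zero => exact absurd hij (Fin.not_lt_zero i)
        | succ j => exact lt_of_le_of_lt (hy.monotone (Fin.le_castSucc_iff.2 hij)) (h j).1
  have h := lintegral_box_vandermondeProd 0 (a := fun i : Fin k => y i.castSucc)
    (b := fun i : Fin k => y i.succ) (fun i => (hy Fin.castSucc_lt_succ).le)
    (fun i => (hy0 _).le) (fun i j hij => hy.monotone (Fin.le_def.2 (Fin.lt_def.1 hij)))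
  rw [det_sub_pred_eq] at h
  rw [hset, ← h]
  simp

end Determinants

/-! ### Gaussian matrices -/

theorem measurable_pi_comp {ι α β : Type*} [MeasurableSpace α] [MeasurableSpace β] {f : α → β}
    (hf : Measurable f) : Measurable fun (x : ι → α) i => f (x i) :=
  measurable_pi_lambda _ fun i => hf.comp (measurable_pi_apply i)

theorem pi_map_curry {ι κ E : Type*} [Fintype ι] [Fintype κ] [MeasurableSpace E] (μ : Measure E)
    [IsProbabilityMeasure μ] :
    (Measure.pi fun _ : ι × κ => μ).map (MeasurableEquiv.curry ι κ E) =
      Measure.pi fun _ : ι => Measure.pi fun _ : κ => μ := by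
  have h := Measure.infinitePi_map_curry (ι := ι) (κ := κ) fun _ _ => μ
  simpa only [Measure.infinitePi_eq_pi] using h

/-- The law of an `m × n` matrix with independent standard complex Gaussian entries. -/
noncomputable def ginibreLaw (m n : ℕ) : Measure (Fin m → Fin n → ℂ) :=
  Measure.pi fun _ => Measure.pi fun _ => complexGaussian

instance (m n : ℕ) : IsProbabilityMeasure (ginibreLaw m n) := by
  unfold ginibreLaw; infer_instance

theorem map_bool_pi_gaussianReal :
    (Measure.pi fun _ : Bool => gaussianReal 0 (1 / 2 : ℝ≥0)).map
      (fun f : Bool → ℝ => (⟨f true, f false⟩ : ℂ)) = complexGaussian := by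
  have hm : Measurable fun f : Bool → ℝ => (f true, f false) := by fun_prop
  have h : (gaussianReal 0 (1 / 2 : ℝ≥0)).prod (gaussianReal 0 (1 / 2 : ℝ≥0)) =
      (Measure.pi fun _ : Bool => gaussianReal 0 (1 / 2 : ℝ≥0)).map
        fun f : Bool → ℝ => (f true, f false) := by
    refine Measure.prod_eq fun s t hs ht => ?_
    have hpre : (fun f : Bool → ℝ => (f true, f false)) ⁻¹' s ×ˢ t =
        Set.univ.pi fun b : Bool => if b then s else t := by
      ext f
      simp [and_comm]
    rw [Measure.map_apply hm (hs.prod ht), hpre, Measure.pi_pi]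
    simp
  rw [complexGaussian, h, Measure.map_map Complex.measurableEquivRealProd.symm.measurable hm]
  rfl

theorem IsComplexGinibre.hasLaw {Ω : Type*} [MeasurableSpace Ω] {P : Measure Ω} {m n : ℕ}
    {X : Ω → Matrix (Fin m) (Fin n) ℂ} (hX : IsComplexGinibre X P) :
    HasLaw (fun ω i j => X ω i j) (ginibreLaw m n) P := by
  let γ : Measure ℝ := gaussianReal 0 (1 / 2 : ℝ≥0)
  have h1 : HasLaw (fun ω (k : Fin m × Fin n × Bool) =>
      if k.2.2 then (X ω k.1 k.2.1).re else (X ω k.1 k.2.1).im)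
      (Measure.pi fun _ : Fin m × Fin n × Bool => γ) P := by
    refine iIndepFun.hasLaw_pi (fun k => ?_) hX.indep
    obtain ⟨i, j, b⟩ := k
    cases b
    · exact hX.im_law i j
    · exact hX.re_law i j
  let φ : (Bool → ℝ) → ℂ := fun f => ⟨f true, f false⟩
  have hφ : Measurable φ :=
    Complex.measurableEquivRealProd.symm.measurable.comp
      (show Measurable fun f : Bool → ℝ => (f true, f false) by fun_prop)
  let Φ : (Fin n × Bool → ℝ) → Fin n → ℂ := fun f j => φ fun b => f (j, b)
  have hΦ : (Measure.pi fun _ : Fin n × Bool => γ).map Φ =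
      Measure.pi fun _ => complexGaussian := by
    have hcomp : Φ = (fun (f : Fin n → Bool → ℝ) j => φ (f j)) ∘
        MeasurableEquiv.curry (Fin n) Bool ℝ := rfl
    have hp : IsProbabilityMeasure ((Measure.pi fun _ : Bool => γ).map φ) :=
      Measure.isProbabilityMeasure_map hφ.aemeasurable
    rw [hcomp, ← Measure.map_map (measurable_pi_comp hφ) (MeasurableEquiv.measurable _), pi_map_curry,
      Measure.pi_map_pi fun _ => hφ.aemeasurable]
    congr 1
    ext1 _
    exact map_bool_pi_gaussianReal
  have hΦm : Measurable Φ :=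
    (measurable_pi_comp hφ).comp (MeasurableEquiv.curry (Fin n) Bool ℝ).measurable
  have h2 : HasLaw (fun (f : Fin m × Fin n × Bool → ℝ) i => Φ fun q => f (i, q))
      (ginibreLaw m n) (Measure.pi fun _ : Fin m × Fin n × Bool => γ) := by
    refine ⟨((measurable_pi_comp hΦm).comp
      (MeasurableEquiv.curry (Fin m) (Fin n × Bool) ℝ).measurable).aemeasurable, ?_⟩
    have hcomp : (fun (f : Fin m × Fin n × Bool → ℝ) i => Φ fun q => f (i, q)) =
        (fun (f : Fin m → Fin n × Bool → ℝ) i => Φ (f i)) ∘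
        MeasurableEquiv.curry (Fin m) (Fin n × Bool) ℝ := rfl
    have hp : IsProbabilityMeasure ((Measure.pi fun _ : Fin n × Bool => γ).map Φ) :=
      Measure.isProbabilityMeasure_map hΦm.aemeasurable
    rw [hcomp, ← Measure.map_map (measurable_pi_comp hΦm) (MeasurableEquiv.measurable _), pi_map_curry,
      Measure.pi_map_pi fun _ => hΦm.aemeasurable, ginibreLaw]
    simp_rw [hΦ]
  exact h2.comp h1

theorem measurePreserving_conj_complexGaussian :
    MeasurePreserving (starRingEnd ℂ) complexGaussian complexGaussian := by
  refine ⟨Complex.continuous_conj.measurable, ?_⟩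
  have hm : Measurable (starRingEnd ℂ) := Complex.continuous_conj.measurable
  have hvol : MeasurePreserving (starRingEnd ℂ) (volume : Measure ℂ) volume :=
    Complex.conjLIE.measurePreserving
  refine Measure.ext_of_lintegral _ fun g hg => ?_
  rw [lintegral_map hg hm, complexGaussian_eq_withDensity,
    lintegral_withDensity_eq_lintegral_mul _ measurable_complexGaussianPDF
      (show Measurable fun z => g (starRingEnd ℂ z) from hg.comp hm),
    lintegral_withDensity_eq_lintegral_mul _ measurable_complexGaussianPDF hg,
    ← hvol.lintegral_comp (measurable_complexGaussianPDF.mul hg)]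
  refine lintegral_congr fun z => ?_
  simp [complexGaussianPDF, Complex.normSq_conj]

/-- The conjugate transpose of a Gaussian matrix is a Gaussian matrix. -/
theorem measurePreserving_conjTranspose_ginibreLaw (m n : ℕ) :
    MeasurePreserving (fun (X : Fin m → Fin n → ℂ) j i => starRingEnd ℂ (X i j))
      (ginibreLaw m n) (ginibreLaw n m) := by
  let F : (Fin m × Fin n → ℂ) → Fin n × Fin m → ℂ := fun f q => starRingEnd ℂ (f q.swap)
  have hm : Measurable (starRingEnd ℂ) := Complex.continuous_conj.measurable
  have hc : (Measure.pi fun _ : Fin m × Fin n => complexGaussian).map F =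
      Measure.pi fun _ => complexGaussian := by
    have h1 := Measure.pi_map_piCongrLeft (Equiv.prodComm (Fin m) (Fin n)) (β := fun _ => ℂ)
      fun _ => complexGaussian
    have hp : IsProbabilityMeasure (complexGaussian.map (starRingEnd ℂ)) :=
      Measure.isProbabilityMeasure_map hm.aemeasurable
    have h2 : F = (fun (f : Fin n × Fin m → ℂ) q => starRingEnd ℂ (f q)) ∘
        MeasurableEquiv.piCongrLeft (fun _ => ℂ) (Equiv.prodComm (Fin m) (Fin n)) := by
      ext f q
      rfl
    rw [h2, ← Measure.map_map (measurable_pi_comp hm)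
      (MeasurableEquiv.measurable _), h1, Measure.pi_map_pi fun _ => hm.aemeasurable]
    simp_rw [measurePreserving_conj_complexGaussian.map_eq]
  have hFm : Measurable F := measurable_pi_lambda _ fun q => hm.comp (measurable_pi_apply _)
  have hGm : Measurable fun (X : Fin m → Fin n → ℂ) j i => starRingEnd ℂ (X i j) :=
    measurable_pi_lambda _ fun j => measurable_pi_lambda _ fun i =>
      hm.comp ((measurable_pi_apply j).comp (measurable_pi_apply i))
  refine ⟨hGm, ?_⟩
  rw [ginibreLaw, ← pi_map_curry, Measure.map_map hGm (MeasurableEquiv.measurable _), ginibreLaw,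
    ← pi_map_curry, ← hc, Measure.map_map (MeasurableEquiv.measurable _) hFm]
  rfl

/-! ### The law of the ordered squared singular values -/

theorem isHermitian_gram {m n : ℕ} (X : Fin m → Fin n → ℂ) :
    ((Matrix.of X).conjTranspose * Matrix.of X).IsHermitian :=
  Matrix.isHermitian_conjTranspose_mul_self _

theorem measurable_gram_apply {m n : ℕ} (i j : Fin n) :
    Measurable fun X : Fin m → Fin n → ℂ => ((Matrix.of X).conjTranspose * Matrix.of X) i j := by
  have hm : Measurable (starRingEnd ℂ) := Complex.continuous_conj.measurable
  simp only [Matrix.mul_apply, Matrix.conjTranspose_apply, Matrix.of_apply]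
  refine Finset.measurable_sum _ fun l _ => ?_
  have h : ∀ c : Fin n, Measurable fun X : Fin m → Fin n → ℂ => X l c := fun c =>
    (measurable_pi_apply c).comp (measurable_pi_apply l)
  exact (hm.comp (h i)).mul (h j)

/-- The ordered eigenvalues of `Xᴴ * X`. -/
noncomputable def gramSpectrum {m n : ℕ} (X : Fin m → Fin n → ℂ) : Fin n → ℝ :=
  orderedSpectrum ((Matrix.of X).conjTranspose * Matrix.of X)

theorem measurable_gramSpectrum (m n : ℕ) : Measurable (gramSpectrum (m := m) (n := n)) :=
  measurable_orderedSpectrum measurable_gram_apply isHermitian_gram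

/-- The law of the ordered squared singular values of a Gaussian matrix. -/
noncomputable def spectralLaw (m n : ℕ) : Measure (Fin n → ℝ) := (ginibreLaw m n).map gramSpectrum

instance (m n : ℕ) : IsProbabilityMeasure (spectralLaw m n) :=
  Measure.isProbabilityMeasure_map (measurable_gramSpectrum m n).aemeasurable

theorem IsComplexGinibre.hasLaw_sqSingularValues {Ω : Type*} [MeasurableSpace Ω] {P : Measure Ω}
    {m n : ℕ} {X : Ω → Matrix (Fin m) (Fin n) ℂ} (hX : IsComplexGinibre X P) :
    HasLaw (fun ω => sqSingularValues (X ω)) (spectralLaw m n) P := by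
  have h : HasLaw (gramSpectrum (m := m) (n := n)) (spectralLaw m n) (ginibreLaw m n) :=
    ⟨(measurable_gramSpectrum m n).aemeasurable, rfl⟩
  have := h.comp hX.hasLaw
  refine this.congr (Filter.Eventually.of_forall fun ω => ?_)
  exact sqSingularValues_eq_orderedSpectrum _

/-- The transition operator of adding a Gaussian rank one perturbation, on functions of the
ordered spectrum. -/
noncomputable def spectralTransition {n : ℕ} (g : (Fin n → ℝ) → ℝ≥0∞) (x : Fin n → ℝ) : ℝ≥0∞ :=
  ∫⁻ v, g (orderedSpectrum (Matrix.diagonal (fun i => (x i : ℂ)) + Matrix.vecMulVec (star v) v))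
    ∂(Measure.pi fun _ : Fin n => complexGaussian)

theorem measurable_spectralTransition {n : ℕ} {g : (Fin n → ℝ) → ℝ≥0∞} (hg : Measurable g) :
    Measurable (spectralTransition g) := by
  refine Measurable.lintegral_prod_right' (f := fun p : (Fin n → ℝ) × (Fin n → ℂ) =>
    g (orderedSpectrum (Matrix.diagonal (fun i => (p.1 i : ℂ)) +
      Matrix.vecMulVec (star p.2) p.2))) (hg.comp ?_)
  exact measurable_orderedSpectrum_add_vecMulVec
    (f := fun p : (Fin n → ℝ) × (Fin n → ℂ) => Matrix.diagonal fun i => (p.1 i : ℂ))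
    (measurable_diagonal_ofReal_apply measurable_fst) (fun p => isHermitian_diagonal_ofReal p.1)
    measurable_snd

/-- The Gram matrix is a sum over rows. Row 0 is independent of the others and adds a Gaussian rank
one term, which is integrated first. -/
theorem lintegral_spectralLaw_succ_eq_lintegral_ginibreLaw (m n : ℕ) {g : (Fin n → ℝ) → ℝ≥0∞}
    (hg : Measurable g) :
    ∫⁻ x, g x ∂(spectralLaw (m + 1) n) =
      ∫⁻ X, spectralTransition g (gramSpectrum X) ∂(ginibreLaw m n) := by
  let γ : Measure (Fin n → ℂ) := Measure.pi fun _ => complexGaussian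
  rw [spectralLaw, lintegral_map hg (measurable_gramSpectrum _ _), ginibreLaw,
    ← ((measurePreserving_piFinSuccAbove (fun _ : Fin (m + 1) => γ) 0).symm).lintegral_comp_emb
      (MeasurableEquiv.measurableEmbedding _)]
  have h1 : ∀ p : (Fin n → ℂ) × (Fin m → Fin n → ℂ),
      gramSpectrum ((MeasurableEquiv.piFinSuccAbove (fun _ : Fin (m + 1) => Fin n → ℂ) 0).symm p) =
      orderedSpectrum ((Matrix.of p.2).conjTranspose * Matrix.of p.2 +
        Matrix.vecMulVec (star p.1) p.1) := by
    intro p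
    rw [gramSpectrum]
    congr 1
    ext i j
    simp only [Matrix.mul_apply, Fin.sum_univ_succ, Matrix.add_apply, Matrix.vecMulVec_apply,
      Matrix.conjTranspose_apply, Matrix.of_apply]
    rw [add_comm]
    rfl
  simp_rw [h1]
  have hmeas : Measurable fun p : (Fin n → ℂ) × (Fin m → Fin n → ℂ) =>
      g (orderedSpectrum ((Matrix.of p.2).conjTranspose * Matrix.of p.2 +
        Matrix.vecMulVec (star p.1) p.1)) :=
    hg.comp (measurable_orderedSpectrum_add_vecMulVec
      (f := fun p : (Fin n → ℂ) × (Fin m → Fin n → ℂ) =>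
        (Matrix.of p.2).conjTranspose * Matrix.of p.2)
      (fun i j => (measurable_gram_apply i j).comp measurable_snd)
      (fun p => isHermitian_gram p.2) measurable_fst)
  refine (lintegral_prod_symm _ hmeas.aemeasurable).trans (lintegral_congr fun X => ?_)
  exact lintegral_orderedSpectrum_add_vecMulVec (isHermitian_gram X) hg

theorem lintegral_spectralLaw_succ (m n : ℕ) {g : (Fin n → ℝ) → ℝ≥0∞} (hg : Measurable g) :
    ∫⁻ x, g x ∂(spectralLaw (m + 1) n) = ∫⁻ x, spectralTransition g x ∂(spectralLaw m n) := by
  rw [lintegral_spectralLaw_succ_eq_lintegral_ginibreLaw m n hg, spectralLaw,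
    lintegral_map (measurable_spectralTransition hg) (measurable_gramSpectrum m n)]

/-- The characteristic polynomials of X*X and XX* differ by one factor of the variable. The
eigenvalues are nonnegative, so the extra zero comes first. -/
theorem gramSpectrum_eq_cons {k : ℕ} (X : Fin k → Fin (k + 1) → ℂ) :
    gramSpectrum X = (Fin.cons 0 (gramSpectrum fun j i => starRingEnd ℂ (X i j)) :
      Fin (k + 1) → ℝ) := by
  have hB : (Matrix.of fun j i => starRingEnd ℂ (X i j)) = (Matrix.of X).conjTranspose := by
    ext i j; rfl
  have hH := Matrix.isHermitian_conjTranspose_mul_self (Matrix.of X).conjTranspose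
  refine orderedSpectrum_eq_of_charpoly (isHermitian_gram X) ?_ ?_
  · intro i j hij
    rw [gramSpectrum, hB]
    induction j using Fin.cases with
    | zero => rw [Fin.le_zero_iff.1 hij]
    | succ j =>
      induction i using Fin.cases with
      | zero => exact orderedSpectrum_conjTranspose_mul_self_nonneg _ j
      | succ i => exact monotone_orderedSpectrum hH (Fin.succ_le_succ_iff.1 hij)
  · rw [Matrix.charpoly_mul_comm_of_le _ _ (by simp), Fin.prod_univ_succ]
    simp only [Fin.cons_zero, Fin.cons_succ, Fintype.card_fin, Nat.add_sub_cancel_left, pow_one]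
    rw [gramSpectrum, hB, ← charpoly_eq_prod_orderedSpectrum hH]
    simp

theorem lintegral_spectralLaw_square (k : ℕ) {g : (Fin (k + 1) → ℝ) → ℝ≥0∞} (hg : Measurable g) :
    ∫⁻ x, g x ∂(spectralLaw (k + 1) (k + 1)) =
      ∫⁻ x, spectralTransition g (Fin.cons 0 x : Fin (k + 1) → ℝ) ∂(spectralLaw (k + 1) k) := by
  have hcons : Measurable fun x : Fin k → ℝ => (Fin.cons 0 x : Fin (k + 1) → ℝ) := by
    refine measurable_pi_lambda _ fun i => ?_
    induction i using Fin.cases with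
    | zero => exact measurable_const
    | succ i => exact measurable_pi_apply i
  have hT : Measurable fun x : Fin k → ℝ => spectralTransition g (Fin.cons 0 x) :=
    (measurable_spectralTransition hg).comp hcons
  rw [lintegral_spectralLaw_succ_eq_lintegral_ginibreLaw k (k + 1) hg, spectralLaw,
    lintegral_map hT (measurable_gramSpectrum _ _),
    ← (measurePreserving_conjTranspose_ginibreLaw k (k + 1)).lintegral_comp
      (show Measurable fun X => spectralTransition g (Fin.cons 0 (gramSpectrum X)) from
        hT.comp (measurable_gramSpectrum _ _))]
  exact lintegral_congr fun X => by rw [gramSpectrum_eq_cons X]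

/-! ### The density of the ordered squared singular values -/

/-- The second factor is the one that cancels against the denominator of the transition kernel. -/
theorem laguerreWeight_eq (n ν : ℕ) (x : Fin n → ℝ) : laguerreWeight n ν x =
    ((∏ i, x i ^ ν) * vandermondeProd x) * (vandermondeProd x * Real.exp (-∑ i, x i)) := by
  rw [laguerreWeight, Finset.prod_mul_distrib, ← Real.exp_sum, Finset.sum_neg_distrib]
  simp_rw [Finset.prod_pow]
  rw [← vandermondeProd]
  ring

theorem laguerreWeight_nonneg {n ν : ℕ} {x : Fin n → ℝ} (hx : ∀ i, 0 < x i) :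
    0 ≤ laguerreWeight n ν x :=
  mul_nonneg (Finset.prod_nonneg fun _ _ => Finset.prod_nonneg fun _ _ => sq_nonneg _)
    (Finset.prod_nonneg fun i _ => mul_nonneg (pow_nonneg (hx i).le _) (Real.exp_pos _).le)

theorem measurable_vandermondeProd (n : ℕ) : Measurable (vandermondeProd (n := n)) := by
  unfold vandermondeProd
  exact Finset.measurable_prod _ fun i _ => Finset.measurable_prod _ fun j _ => by fun_prop

theorem measurable_laguerreWeight (n ν : ℕ) : Measurable (laguerreWeight n ν) := by
  unfold laguerreWeight
  refine Measurable.mul ?_ ?_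
  · exact Finset.measurable_prod _ fun i _ => Finset.measurable_prod _ fun j _ => by fun_prop
  · exact Finset.measurable_prod _ fun i _ => by fun_prop

/-- The open Weyl chamber `0 < x₀ < ⋯ < xₙ₋₁`. -/
def orderedOrthant (n : ℕ) : Set (Fin n → ℝ) := {x | (∀ j, 0 < x j) ∧ StrictMono x}

theorem measurableSet_orthant (n : ℕ) : MeasurableSet {x : Fin n → ℝ | ∀ j, 0 < x j} := by
  simp only [Set.ofPred_forall]
  exact MeasurableSet.iInter fun i => measurableSet_lt (by fun_prop) (by fun_prop)

theorem measurableSet_strictMono (n : ℕ) : MeasurableSet {x : Fin n → ℝ | StrictMono x} := by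
  simp only [StrictMono, Set.ofPred_forall]
  exact MeasurableSet.iInter fun i => MeasurableSet.iInter fun j => MeasurableSet.iInter fun _ =>
    measurableSet_lt (by fun_prop) (by fun_prop)

theorem measurableSet_orderedOrthant (n : ℕ) : MeasurableSet (orderedOrthant n) :=
  (measurableSet_orthant n).inter (measurableSet_strictMono n)

theorem lintegral_lintegral_section_swap {α β : Type*} [MeasurableSpace α] [MeasurableSpace β]
    (μ : Measure α) (ν : Measure β) [SFinite μ] [SFinite ν] {R : Set (α × β)}
    (hR : MeasurableSet R) {a : α → ℝ≥0∞} {b : β → ℝ≥0∞} (ha : Measurable a) (hb : Measurable b) :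
    ∫⁻ x, ∫⁻ y in {y | (x, y) ∈ R}, a x * b y ∂ν ∂μ =
      ∫⁻ y, b y * ∫⁻ x in {x | (x, y) ∈ R}, a x ∂μ ∂ν := by
  have h1 : ∀ x, ∫⁻ y in {y | (x, y) ∈ R}, a x * b y ∂ν =
      ∫⁻ y, R.indicator (fun p => a p.1 * b p.2) (x, y) ∂ν := fun x => by
    rw [← lintegral_indicator (show MeasurableSet {y | (x, y) ∈ R} from
      hR.preimage measurable_prodMk_left)]
    rfl
  have h2 : ∀ y, b y * ∫⁻ x in {x | (x, y) ∈ R}, a x ∂μ =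
      ∫⁻ x, R.indicator (fun p => a p.1 * b p.2) (x, y) ∂μ := fun y => by
    rw [← lintegral_const_mul _ ha, ← lintegral_indicator
      (show MeasurableSet {x | (x, y) ∈ R} from hR.preimage measurable_prodMk_right)]
    refine lintegral_congr fun x => ?_
    by_cases hx : (x, y) ∈ R
    · rw [Set.indicator_of_mem hx, Set.indicator_of_mem (by exact hx), mul_comm]
    · rw [Set.indicator_of_notMem hx, Set.indicator_of_notMem (by exact hx)]
  simp_rw [h1, h2]
  exact lintegral_lintegral_swap (((ha.comp measurable_fst).mul
    (hb.comp measurable_snd)).indicator hR).aemeasurable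

/-- One step of the recursion for the density of the ordered squared singular values. -/
theorem exists_density_of_spectralTransition {k n ν ν' : ℕ} {μ : Measure (Fin k → ℝ)}
    {μ' : Measure (Fin n → ℝ)} {φ : (Fin k → ℝ) → Fin n → ℝ} {α : (Fin k → ℝ) → ℝ} {c : ℝ}
    (hφm : Measurable φ) (hαm : Measurable α) (hc : 0 ≤ c)
    (hφ : ∀ x ∈ orderedOrthant k, StrictMono (φ x))
    (hmono : ∀ x, (∀ j, 0 < x j) → StrictMono (φ x) → StrictMono x)
    (hpos : ∀ x y, (∀ j, 0 < x j) → Interlaces (φ x) y → ∀ j, 0 < y j)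
    (hα0 : ∀ x ∈ orderedOrthant k, 0 ≤ α x)
    (hα : ∀ x ∈ orderedOrthant k, laguerreWeight k ν x =
      α x * (vandermondeProd (φ x) * Real.exp (-∑ i, φ x i)))
    (hint : ∀ y ∈ orderedOrthant n,
      ∫⁻ x in {x | (∀ j, 0 < x j) ∧ Interlaces (φ x) y}, ENNReal.ofReal (α x) =
        ENNReal.ofReal (c * ((∏ i, y i ^ ν') * vandermondeProd y)))
    (hμ' : ∀ g : (Fin n → ℝ) → ℝ≥0∞, Measurable g →
      ∫⁻ y, g y ∂μ' = ∫⁻ x, spectralTransition g (φ x) ∂μ)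
    (hμ : ∃ C : ℝ≥0∞, μ = C • (volume.restrict (orderedOrthant k)).withDensity
      fun x => ENNReal.ofReal (laguerreWeight k ν x)) :
    ∃ C : ℝ≥0∞, μ' = C • (volume.restrict (orderedOrthant n)).withDensity
      fun x => ENNReal.ofReal (laguerreWeight n ν' x) := by
  obtain ⟨C, hC⟩ := hμ
  refine ⟨C * ENNReal.ofReal c, Measure.ext_of_lintegral _ fun g hg => ?_⟩
  have hT := (measurable_spectralTransition hg).comp hφm
  have hT' : Measurable fun x => spectralTransition g (φ x) := hT
  have hwm : ∀ n ν, Measurable fun x : Fin n → ℝ => ENNReal.ofReal (laguerreWeight n ν x) :=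
    fun n ν => (measurable_laguerreWeight n ν).ennreal_ofReal
  -- Here φ x is the spectrum before the perturbation, either x itself or x with a zero prepended.
  -- The factor α is what remains of the weight once Δ(φ x) exp(-Σ φ x) has cancelled against the
  -- kernel, so the joint density on `R` splits as α(x) times a function of y.
  let R : Set ((Fin k → ℝ) × (Fin n → ℝ)) := {p | (∀ j, 0 < p.1 j) ∧ Interlaces (φ p.1) p.2}
  have hR : MeasurableSet R := ((measurableSet_orthant k).preimage measurable_fst).inter
    (measurableSet_interlaces.preimage ((hφm.comp measurable_fst).prodMk measurable_snd))
  let b : (Fin n → ℝ) → ℝ≥0∞ := fun y =>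
    ENNReal.ofReal (vandermondeProd y * Real.exp (-∑ i, y i)) * g y
  have hb : Measurable b := by
    refine Measurable.mul (Measurable.ennreal_ofReal ((measurable_vandermondeProd n).mul ?_)) hg
    fun_prop
  have hleft : ∫⁻ x in orderedOrthant k, ENNReal.ofReal (laguerreWeight k ν x) *
      spectralTransition g (φ x) = ∫⁻ x, ∫⁻ y in {y | (x, y) ∈ R}, ENNReal.ofReal (α x) * b y := by
    rw [← lintegral_indicator (measurableSet_orderedOrthant k)]
    refine lintegral_congr fun x => ?_
    by_cases hx : x ∈ orderedOrthant k
    · have hset : {y | (x, y) ∈ R} = {y | Interlaces (φ x) y} := by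
        ext y
        exact ⟨fun h => h.2, fun h => ⟨hx.1, h⟩⟩
      have hm : MeasurableSet {y | Interlaces (φ x) y} :=
        measurableSet_interlaces.preimage measurable_prodMk_left
      rw [Set.indicator_of_mem hx, spectralTransition,
        lintegral_orderedSpectrum_diagonal_add (hφ x hx) hg, hset,
        ← lintegral_const_mul' _ _ ENNReal.ofReal_ne_top]
      refine setLIntegral_congr_fun hm fun y hy => ?_
      simp only [b]
      rw [← mul_assoc, ← mul_assoc, ← ENNReal.ofReal_mul (laguerreWeight_nonneg hx.1),
        ← ENNReal.ofReal_mul (hα0 x hx), hα x hx]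
      congr 2
      have hv := (hφ x hx).vandermondeProd_pos.ne'
      have he : Real.exp (-∑ i, y i) =
          Real.exp (-∑ i, φ x i) * Real.exp (-(∑ i, y i - ∑ i, φ x i)) := by
        rw [← Real.exp_add]
        congr 1
        ring
      rw [he]
      field_simp
    · have hset : {y | (x, y) ∈ R} = ∅ := by
        ext y
        simp only [Set.mem_empty_iff_false, iff_false]
        exact fun h => hx ⟨h.1, hmono x h.1 h.2.strictMono_left⟩
      rw [Set.indicator_of_notMem hx, hset, Measure.restrict_empty, lintegral_zero_measure]
  -- After Tonelli the inner integral is the box integral `hint`, which supplies the second factor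
  -- Δ(y) of the new weight.
  have hright : ∫⁻ y, b y * ∫⁻ x in {x | (x, y) ∈ R}, ENNReal.ofReal (α x) =
      ENNReal.ofReal c * ∫⁻ y in orderedOrthant n, ENNReal.ofReal (laguerreWeight n ν' y) * g y := by
    rw [← lintegral_const_mul' _ _ ENNReal.ofReal_ne_top,
      ← lintegral_indicator (measurableSet_orderedOrthant n)]
    refine lintegral_congr fun y => ?_
    by_cases hy : y ∈ orderedOrthant n
    · have h := hint y hy
      rw [Set.indicator_of_mem hy]
      change b y * ∫⁻ x in {x | (∀ j, 0 < x j) ∧ Interlaces (φ x) y}, ENNReal.ofReal (α x) = _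
      have hnn : 0 ≤ (∏ i, y i ^ ν') * vandermondeProd y :=
        mul_nonneg (Finset.prod_nonneg fun i _ => pow_nonneg (hy.1 i).le _)
          hy.2.vandermondeProd_pos.le
      rw [h, laguerreWeight_eq, ENNReal.ofReal_mul hc, ENNReal.ofReal_mul hnn]
      simp only [b]
      ring
    · have hset : {x | (x, y) ∈ R} = ∅ := by
        ext x
        simp only [Set.mem_empty_iff_false, iff_false]
        exact fun h => hy ⟨hpos x y h.1 h.2, h.2.strictMono_right⟩
      rw [Set.indicator_of_notMem hy, hset, Measure.restrict_empty, lintegral_zero_measure,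
        mul_zero]
  rw [hμ' g hg, hC, lintegral_smul_measure, lintegral_smul_measure,
    lintegral_withDensity_eq_lintegral_mul _ (hwm k ν) hT',
    lintegral_withDensity_eq_lintegral_mul _ (hwm n ν') hg, smul_eq_mul, smul_eq_mul]
  simp only [Pi.mul_apply]
  rw [hleft, lintegral_lintegral_section_swap volume volume hR hαm.ennreal_ofReal hb, hright,
    mul_assoc]

theorem measurable_prod_pow (n ν : ℕ) : Measurable fun x : Fin n → ℝ => ∏ i, x i ^ ν :=
  Finset.measurable_prod _ fun i _ => by fun_prop

/-- Thus the weight with ν = 1 is Δ(x) Δ(0, x) exp(-Σ x), which is the shape required when the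
kernel starts at (0, x). -/
theorem vandermondeProd_cons_zero {k : ℕ} (x : Fin k → ℝ) :
    vandermondeProd (Fin.cons 0 x : Fin (k + 1) → ℝ) = (∏ i, x i) * vandermondeProd x := by
  simp only [vandermondeProd]
  rw [Fin.prod_univ_succ]
  simp_rw [Fin.prod_Ioi_zero, Fin.prod_Ioi_succ, Fin.cons_zero, Fin.cons_succ, sub_zero]

theorem exists_density_spectralLaw_succ (k ν : ℕ)
    (h : ∃ C : ℝ≥0∞, spectralLaw (k + 1 + ν) (k + 1) =
      C • (volume.restrict (orderedOrthant (k + 1))).withDensity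
        fun x => ENNReal.ofReal (laguerreWeight (k + 1) ν x)) :
    ∃ C : ℝ≥0∞, spectralLaw (k + 1 + (ν + 1)) (k + 1) =
      C • (volume.restrict (orderedOrthant (k + 1))).withDensity
        fun x => ENNReal.ofReal (laguerreWeight (k + 1) (ν + 1) x) := by
  refine exists_density_of_spectralTransition (φ := fun x => x)
    (α := fun x => (∏ i, x i ^ ν) * vandermondeProd x)
    (c := ∏ j : Fin (k + 1), ((ν + (j : ℕ) : ℕ) + 1 : ℝ)⁻¹) measurable_id
    ((measurable_prod_pow _ _).mul (measurable_vandermondeProd _))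
    (Finset.prod_nonneg fun j _ => by positivity) (fun x hx => hx.2) (fun x _ hx => hx)
    (fun x y hx hxy j => (hx j).trans (hxy.1 j))
    (fun x hx => mul_nonneg (Finset.prod_nonneg fun i _ => pow_nonneg (hx.1 i).le _)
      hx.2.vandermondeProd_pos.le)
    (fun x _ => laguerreWeight_eq _ _ x)
    (fun y hy => lintegral_interlaces_vandermondeProd ν hy.1 hy.2)
    (fun g hg => lintegral_spectralLaw_succ (k + 1 + ν) (k + 1) hg) h

theorem exists_density_spectralLaw_square (k : ℕ)
    (h : ∃ C : ℝ≥0∞, spectralLaw (k + 1) k =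
      C • (volume.restrict (orderedOrthant k)).withDensity
        fun x => ENNReal.ofReal (laguerreWeight k 1 x)) :
    ∃ C : ℝ≥0∞, spectralLaw (k + 1) (k + 1) =
      C • (volume.restrict (orderedOrthant (k + 1))).withDensity
        fun x => ENNReal.ofReal (laguerreWeight (k + 1) 0 x) := by
  have hcons : Measurable fun x : Fin k → ℝ => (Fin.cons 0 x : Fin (k + 1) → ℝ) := by
    refine measurable_pi_lambda _ fun i => ?_
    induction i using Fin.cases with
    | zero => exact measurable_const
    | succ i => exact measurable_pi_apply i
  refine exists_density_of_spectralTransition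
    (φ := fun x => (Fin.cons 0 x : Fin (k + 1) → ℝ)) (α := vandermondeProd)
    (c := ∏ j : Fin k, ((0 + (j : ℕ) : ℕ) + 1 : ℝ)⁻¹) hcons (measurable_vandermondeProd _)
    (Finset.prod_nonneg fun j _ => by positivity) (fun x hx => ?_)
    (fun x _ hx i j hij => hx (Fin.succ_lt_succ_iff.2 hij)) (fun x y hx hxy j => ?_)
    (fun x hx => hx.2.vandermondeProd_pos.le) (fun x _ => ?_)
    (fun y hy => ?_) (fun g hg => lintegral_spectralLaw_square k hg) h
  · intro i j hij
    induction j using Fin.cases with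
    | zero => exact absurd hij (Fin.not_lt_zero i)
    | succ j =>
      induction i using Fin.cases with
      | zero => exact hx.1 j
      | succ i => exact hx.2 (Fin.succ_lt_succ_iff.1 hij)
  · refine lt_of_le_of_lt ?_ (hxy.1 j)
    induction j using Fin.cases with
    | zero => exact le_rfl
    | succ j => exact (hx j).le
  · rw [laguerreWeight_eq, vandermondeProd_cons_zero, Fin.sum_univ_succ]
    simp only [Fin.cons_zero, Fin.cons_succ, pow_one, zero_add]
    ring
  · rw [lintegral_interlaces_cons_vandermondeProd hy.1 hy.2]
    simp

/-- Induction on n, and within it on ν. The square case in dimension k+1 uses ν = 1 in dimension k,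
so the outer hypothesis must be available for every ν. -/
theorem exists_density_spectralLaw (n ν : ℕ) : ∃ C : ℝ≥0∞, spectralLaw (n + ν) n =
    C • (volume.restrict (orderedOrthant n)).withDensity
      fun x => ENNReal.ofReal (laguerreWeight n ν x) := by
  induction n generalizing ν with
  | zero =>
    refine ⟨1, ?_⟩
    have hS : orderedOrthant 0 = Set.univ :=
      Set.eq_univ_of_forall fun x => ⟨fun j => j.elim0, fun i => i.elim0⟩
    have hw : (fun x : Fin 0 → ℝ => ENNReal.ofReal (laguerreWeight 0 ν x)) = 1 := by
      ext x; simp [laguerreWeight]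
    rw [hS, hw, Measure.restrict_univ, withDensity_one, one_smul]
    refine Measure.ext fun s _ => ?_
    rcases s.eq_empty_or_nonempty with rfl | hs
    · simp
    · rw [hs.eq_univ, measure_univ, volume_pi, Measure.pi_empty_univ]
  | succ k ih =>
    induction ν with
    | zero => exact exists_density_spectralLaw_square k (ih 1)
    | succ ν ihν => exact exists_density_spectralLaw_succ k ν ihν

/-! ### Symmetrization -/

theorem laguerreWeight_comp_perm (n ν : ℕ) (x : Fin n → ℝ) (σ : Equiv.Perm (Fin n)) :
    laguerreWeight n ν (x ∘ σ) = laguerreWeight n ν x := by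
  have hv : vandermondeProd (x ∘ σ) = ((Equiv.Perm.sign σ : ℤ) : ℝ) * vandermondeProd x := by
    rw [← det_vandermonde_eq_vandermondeProd, ← det_vandermonde_eq_vandermondeProd,
      ← Matrix.det_permute]
    rfl
  have hs : ((Equiv.Perm.sign σ : ℤ) : ℝ) * ((Equiv.Perm.sign σ : ℤ) : ℝ) = 1 := by
    rw [← Int.cast_mul, ← Units.val_mul, Int.units_mul_self, Units.val_one, Int.cast_one]
  have hp : ∏ i, (x ∘ σ) i ^ ν = ∏ i, x i ^ ν := Equiv.prod_comp σ fun i => x i ^ ν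
  have hsum : ∑ i, (x ∘ σ) i = ∑ i, x i := Equiv.sum_comp σ x
  rw [laguerreWeight_eq, laguerreWeight_eq, hv, hp, hsum]
  linear_combination ((∏ i, x i ^ ν) * vandermondeProd x * vandermondeProd x *
    Real.exp (-∑ i, x i)) * hs

theorem volume_coord_eq_coord {n : ℕ} {i j : Fin n} (hij : i ≠ j) :
    volume {x : Fin n → ℝ | x i = x j} = 0 := by
  let E : Submodule ℝ (Fin n → ℝ) :=
    LinearMap.ker (LinearMap.proj (R := ℝ) (φ := fun _ : Fin n => ℝ) i - LinearMap.proj j)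
  have hE : {x : Fin n → ℝ | x i = x j} = (E : Set (Fin n → ℝ)) := by
    ext x
    simp [E, sub_eq_zero]
  rw [hE]
  refine Measure.addHaar_submodule _ _ fun h => ?_
  have : Pi.single i 1 ∈ E := h ▸ Submodule.mem_top
  simp [E, hij.symm] at this

theorem measurable_comp_perm {n : ℕ} (σ : Equiv.Perm (Fin n)) :
    Measurable fun x : Fin n → ℝ => x ∘ σ :=
  measurable_pi_lambda _ fun i => measurable_pi_apply (σ i)

theorem measurePreserving_comp_perm {n : ℕ} (σ : Equiv.Perm (Fin n)) :
    MeasurePreserving (fun x : Fin n → ℝ => x ∘ σ) volume volume := by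
  have h := volume_measurePreserving_piCongrLeft (fun _ : Fin n => ℝ) σ.symm
  have h2 : (MeasurableEquiv.piCongrLeft (fun _ : Fin n => ℝ) σ.symm : (Fin n → ℝ) → Fin n → ℝ) =
      fun x => x ∘ σ := by
    ext x i
    simpa [MeasurableEquiv.coe_piCongrLeft] using
      Equiv.piCongrLeft_apply_apply (fun _ : Fin n => ℝ) σ.symm x (σ i)
  rwa [h2] at h

/-- Sorting brings a vector with distinct positive coordinates into the chamber; coincidences lie in
finitely many hyperplanes. -/
theorem iUnion_perm_orderedOrthant_ae_eq (n : ℕ) :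
    (⋃ σ : Equiv.Perm (Fin n), {x : Fin n → ℝ | x ∘ σ.symm ∈ orderedOrthant n}) =ᵐ[volume]
      {x : Fin n → ℝ | ∀ j, 0 < x j} := by
  have hsub : (⋃ σ : Equiv.Perm (Fin n), {x : Fin n → ℝ | x ∘ σ.symm ∈ orderedOrthant n}) ⊆
      {x : Fin n → ℝ | ∀ j, 0 < x j} := by
    refine Set.iUnion_subset fun σ x hx j => ?_
    have := hx.1 (σ j)
    simpa using this
  refine Filter.EventuallyLE.antisymm (Filter.Eventually.of_forall hsub) ?_
  rw [ae_le_set]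
  refine measure_mono_null (t := ⋃ i : Fin n, ⋃ j : Fin n, ⋃ _ : i ≠ j, {x | x i = x j}) ?_ ?_
  · rintro x ⟨hx, hx'⟩
    by_contra hcon
    simp only [Set.mem_iUnion, not_exists] at hcon
    have hinj : Function.Injective x := fun i j h => by
      by_contra hij
      exact hcon i j hij h
    refine hx' (Set.mem_iUnion.2 ⟨(Tuple.sort x).symm, fun j => hx _, ?_⟩)
    exact (Tuple.monotone_sort x).strictMono_of_injective
      (hinj.comp (Tuple.sort x).injective)
  · exact measure_iUnion_null fun i => measure_iUnion_null fun j => measure_iUnion_null fun hij =>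
      volume_coord_eq_coord hij

theorem pairwise_disjoint_perm_orderedOrthant (n : ℕ) : Pairwise (Function.onFun Disjoint
    fun σ : Equiv.Perm (Fin n) => {x : Fin n → ℝ | x ∘ σ.symm ∈ orderedOrthant n}) := by
  intro σ τ hστ
  rw [Function.onFun, Set.disjoint_left]
  rintro x ⟨_, hσ⟩ ⟨_, hτ⟩
  apply hστ
  have h1 : x ∘ σ.symm = x ∘ τ.symm := by
    refine hσ.monotone.eq_of_map_univ_eq hτ.monotone ?_
    have h : ∀ ρ : Equiv.Perm (Fin n),
        Multiset.map (x ∘ ρ) Finset.univ.val = Multiset.map x Finset.univ.val := fun ρ => by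
      rw [← Multiset.map_map, Multiset.map_univ_val_equiv]
    rw [h, h]
  have hinj : Function.Injective x := by
    have := hσ.injective.comp σ.injective
    simpa [Function.comp_assoc] using this
  have h2 : σ.symm = τ.symm := Equiv.ext fun i => hinj (congrFun h1 i)
  simpa using congrArg Equiv.symm h2

/-- The orthant is tiled, up to a null set, by the images of the Weyl chamber. -/
theorem sum_lintegral_orderedOrthant_comp_perm (n : ℕ) (h : (Fin n → ℝ) → ℝ≥0∞) :
    ∑ σ : Equiv.Perm (Fin n), ∫⁻ x in orderedOrthant n, h (x ∘ σ) =
      ∫⁻ x in {x : Fin n → ℝ | ∀ j, 0 < x j}, h x := by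
  have hm : ∀ σ : Equiv.Perm (Fin n),
      MeasurableSet {x : Fin n → ℝ | x ∘ σ.symm ∈ orderedOrthant n} := fun σ =>
    (measurableSet_orderedOrthant n).preimage (measurable_comp_perm σ.symm)
  rw [← setLIntegral_congr (iUnion_perm_orderedOrthant_ae_eq n),
    lintegral_iUnion hm (pairwise_disjoint_perm_orderedOrthant n), tsum_fintype]
  refine Finset.sum_congr rfl fun σ _ => ?_
  have he : MeasurableEmbedding fun x : Fin n → ℝ => x ∘ σ :=
    (measurable_comp_perm σ).measurableEmbedding fun x y hxy =>
      σ.surjective.injective_comp_right hxy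
  have hpre : (fun x : Fin n → ℝ => x ∘ σ) ⁻¹' {x | x ∘ σ.symm ∈ orderedOrthant n} =
      orderedOrthant n := by
    ext x
    simp [Function.comp_assoc]
  rw [← (measurePreserving_comp_perm σ).setLIntegral_comp_preimage_emb he h
    {x | x ∘ σ.symm ∈ orderedOrthant n}, hpre]

/-! ### The Laguerre ensemble -/

section Normalization

variable (n ν : ℕ)

theorem lintegral_orthant_laguerreWeight :
    ∫⁻ x in {x : Fin n → ℝ | ∀ j, 0 < x j}, ENNReal.ofReal (laguerreWeight n ν x) =
      n.factorial * ∫⁻ x in orderedOrthant n, ENNReal.ofReal (laguerreWeight n ν x) := by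
  rw [← sum_lintegral_orderedOrthant_comp_perm]
  simp_rw [laguerreWeight_comp_perm]
  rw [Finset.sum_const, Finset.card_univ, Fintype.card_perm, Fintype.card_fin, nsmul_eq_mul]

/-- The law has total mass one. This product identity alone forces the integral of the weight to be
finite and nonzero, with no estimate. -/
theorem exists_mul_lintegral_eq_one : ∃ C : ℝ≥0∞,
    C * ∫⁻ x in orderedOrthant n, ENNReal.ofReal (laguerreWeight n ν x) = 1 ∧
    spectralLaw (n + ν) n = C • (volume.restrict (orderedOrthant n)).withDensity
      fun x => ENNReal.ofReal (laguerreWeight n ν x) := by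
  obtain ⟨C, hC⟩ := exists_density_spectralLaw n ν
  refine ⟨C, ?_, hC⟩
  have h : spectralLaw (n + ν) n Set.univ = 1 := measure_univ
  rwa [hC, Measure.smul_apply, withDensity_apply _ MeasurableSet.univ, Measure.restrict_univ] at h

theorem lintegral_orderedOrthant_laguerreWeight_ne_top :
    ∫⁻ x in orderedOrthant n, ENNReal.ofReal (laguerreWeight n ν x) ≠ ∞ := by
  obtain ⟨C, hC, -⟩ := exists_mul_lintegral_eq_one n ν
  intro h
  rw [h] at hC
  by_cases h0 : C = 0
  · simp [h0] at hC
  · simp [ENNReal.mul_top h0] at hC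

theorem lintegral_orderedOrthant_laguerreWeight_ne_zero :
    ∫⁻ x in orderedOrthant n, ENNReal.ofReal (laguerreWeight n ν x) ≠ 0 := by
  obtain ⟨C, hC, -⟩ := exists_mul_lintegral_eq_one n ν
  intro h
  simp [h] at hC

theorem ae_nonneg_laguerreWeight :
    0 ≤ᵐ[volume.restrict {x : Fin n → ℝ | ∀ j, 0 < x j}] laguerreWeight n ν :=
  (ae_restrict_iff' (measurableSet_orthant n)).2
    (Filter.Eventually.of_forall fun _ hx => laguerreWeight_nonneg hx)

theorem integrableOn_laguerreWeight :
    IntegrableOn (laguerreWeight n ν) {x : Fin n → ℝ | ∀ j, 0 < x j} := by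
  refine (lintegral_ofReal_ne_top_iff_integrable
    (measurable_laguerreWeight n ν).aestronglyMeasurable (ae_nonneg_laguerreWeight n ν)).1 ?_
  rw [lintegral_orthant_laguerreWeight]
  exact ENNReal.mul_ne_top (ENNReal.natCast_ne_top _)
    (lintegral_orderedOrthant_laguerreWeight_ne_top n ν)

theorem ofReal_laguerreZ : ENNReal.ofReal (laguerreZ n ν) =
    n.factorial * ∫⁻ x in orderedOrthant n, ENNReal.ofReal (laguerreWeight n ν x) := by
  rw [laguerreZ, ofReal_integral_eq_lintegral_ofReal (integrableOn_laguerreWeight n ν)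
    (ae_nonneg_laguerreWeight n ν), lintegral_orthant_laguerreWeight]

theorem laguerreZ_pos : 0 < laguerreZ n ν := by
  rw [← ENNReal.ofReal_pos, ofReal_laguerreZ]
  exact ENNReal.mul_pos (by exact_mod_cast n.factorial_ne_zero)
    (lintegral_orderedOrthant_laguerreWeight_ne_zero n ν)

theorem spectralLaw_eq_smul_withDensity :
    spectralLaw (n + ν) n = ENNReal.ofReal (n.factorial / laguerreZ n ν) •
      (volume.restrict (orderedOrthant n)).withDensity
        fun x => ENNReal.ofReal (laguerreWeight n ν x) := by
  obtain ⟨C, hC1, hC⟩ := exists_mul_lintegral_eq_one n ν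
  rw [hC]
  congr 1
  have hf : (n.factorial : ℝ≥0∞) ≠ 0 := by exact_mod_cast n.factorial_ne_zero
  rw [ENNReal.ofReal_div_of_pos (laguerreZ_pos n ν), ENNReal.ofReal_natCast, ofReal_laguerreZ,
    ENNReal.eq_inv_of_mul_eq_one_left hC1, ENNReal.div_eq_inv_mul,
    ENNReal.mul_inv (Or.inl hf) (Or.inl (ENNReal.natCast_ne_top _)), mul_comm, ← mul_assoc,
    ENNReal.mul_inv_cancel hf (ENNReal.natCast_ne_top _), one_mul]

theorem spectralLaw_eq_withDensity :
    spectralLaw (n + ν) n = (volume.restrict (orderedOrthant n)).withDensity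
      fun x => ENNReal.ofReal (n.factorial / laguerreZ n ν * laguerreWeight n ν x) := by
  have hc : 0 ≤ n.factorial / laguerreZ n ν :=
    div_nonneg (Nat.cast_nonneg _) (laguerreZ_pos n ν).le
  rw [spectralLaw_eq_smul_withDensity,
    ← withDensity_smul _ (measurable_laguerreWeight n ν).ennreal_ofReal]
  congr 1
  ext x
  rw [ENNReal.ofReal_mul hc]
  rfl

/-- By symmetry of the weight, each permutation carries the chamber density to the same formula on
its own tile, and averaging turns n!/Z into 1/Z. -/
theorem symmetrized_spectralLaw_eq_withDensity :
    ((n.factorial : ℝ≥0∞))⁻¹ • ∑ σ : Equiv.Perm (Fin n),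
        (spectralLaw (n + ν) n).map (fun x => x ∘ σ) =
      (volume.restrict {x : Fin n → ℝ | ∀ j, 0 < x j}).withDensity
        fun x => ENNReal.ofReal (1 / laguerreZ n ν * laguerreWeight n ν x) := by
  have hZ := laguerreZ_pos n ν
  have hwm := (measurable_laguerreWeight n ν).ennreal_ofReal
  have hw : ∀ x, ENNReal.ofReal (1 / laguerreZ n ν * laguerreWeight n ν x) =
      ENNReal.ofReal (1 / laguerreZ n ν) * ENNReal.ofReal (laguerreWeight n ν x) := fun x =>
    ENNReal.ofReal_mul (by positivity)
  refine Measure.ext_of_lintegral _ fun g hg => ?_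
  simp_rw [hw]
  rw [lintegral_smul_measure, lintegral_finsetSum_measure,
    lintegral_withDensity_eq_lintegral_mul _ (hwm.const_mul _) hg, spectralLaw_eq_smul_withDensity]
  obtain ⟨G, hG⟩ : ∃ G : (Fin n → ℝ) → ℝ≥0∞,
      G = fun y => ENNReal.ofReal (laguerreWeight n ν y) * g y := ⟨_, rfl⟩
  have h1 : ∀ σ : Equiv.Perm (Fin n), ∫⁻ y, g y ∂(Measure.map (fun x => x ∘ σ)
      (ENNReal.ofReal (n.factorial / laguerreZ n ν) •
        (volume.restrict (orderedOrthant n)).withDensity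
          fun x => ENNReal.ofReal (laguerreWeight n ν x))) =
      ENNReal.ofReal (n.factorial / laguerreZ n ν) * ∫⁻ x in orderedOrthant n,
        G (x ∘ σ) := by
    intro σ
    rw [lintegral_map hg (measurable_comp_perm σ), lintegral_smul_measure,
      lintegral_withDensity_eq_lintegral_mul _ hwm
        (show Measurable fun x : Fin n → ℝ => g (x ∘ σ) from hg.comp (measurable_comp_perm σ)),
      smul_eq_mul]
    simp only [Pi.mul_apply, laguerreWeight_comp_perm, hG]
  rw [Finset.sum_congr rfl fun σ _ => h1 σ, ← Finset.mul_sum, sum_lintegral_orderedOrthant_comp_perm, smul_eq_mul, ← mul_assoc]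
  have hf : (n.factorial : ℝ≥0∞) ≠ 0 := by exact_mod_cast n.factorial_ne_zero
  have hcoef : (n.factorial : ℝ≥0∞)⁻¹ * ENNReal.ofReal (n.factorial / laguerreZ n ν) =
      ENNReal.ofReal (1 / laguerreZ n ν) := by
    rw [div_eq_mul_one_div, ENNReal.ofReal_mul (Nat.cast_nonneg _), ENNReal.ofReal_natCast,
      ← mul_assoc, ENNReal.inv_mul_cancel hf (ENNReal.natCast_ne_top _), one_mul]
  have hGm : Measurable G := hG ▸ hwm.mul hg
  rw [hcoef, ← lintegral_const_mul _ hGm]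
  simp only [Pi.mul_apply, mul_assoc, hG]

end Normalization

theorem corollary5p5 {Ω : Type*} [MeasurableSpace Ω] (P : Measure Ω) [IsProbabilityMeasure P]
    (m n ν : ℕ) (hν : m = n + ν) (X : Ω → Matrix (Fin m) (Fin n) ℂ)
    (hX : IsComplexGinibre X P) :
    -- the normalization constant is a convergent, positive integral
    IntegrableOn (laguerreWeight n ν) {x | ∀ j, 0 < x j} ∧
    0 < laguerreZ n ν ∧
    -- joint density of the unordered squared singular values, on the positive orthant
    unorderedLaw (fun ω => sqSingularValues (X ω)) P =
      (volume.restrict {x : Fin n → ℝ | ∀ j, 0 < x j}).withDensity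
        (fun x => ENNReal.ofReal (1 / laguerreZ n ν * laguerreWeight n ν x)) ∧
    -- joint density of the ordered squared singular values, on `0 < x_1 < ⋯ < x_n`
    P.map (fun ω => sqSingularValues (X ω)) =
      (volume.restrict {x : Fin n → ℝ | (∀ j, 0 < x j) ∧ StrictMono x}).withDensity
        (fun x => ENNReal.ofReal (n.factorial / laguerreZ n ν * laguerreWeight n ν x)) := by
  subst hν
  have hlaw := hX.hasLaw_sqSingularValues
  refine ⟨integrableOn_laguerreWeight n ν, laguerreZ_pos n ν, ?_, ?_⟩
  · rw [← symmetrized_spectralLaw_eq_withDensity, unorderedLaw, ← hlaw.map_eq]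
    congr 1
    refine Finset.sum_congr rfl fun σ _ => ?_
    rw [AEMeasurable.map_map_of_aemeasurable (measurable_comp_perm σ).aemeasurable
      hlaw.aemeasurable]
    rfl
  · rw [hlaw.map_eq]
    exact spectralLaw_eq_withDensity n ν
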